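/- For a permutation $\pi_n=(\pi_{n1},\dots,\pi_{nn})$ of $\{1,\dots,n\}$, an entry $\pi_{nj}$ is a lower (upper) record if it is the minimum (maximum) of $\pi_{n1},\dots,\pi_{nj}$; the records with $j>1$ are called proper. Let $r_0=\pi_{n1}$, let $r_{-\ell}<\dots<r_{-1}$ be the proper lower record values and $r_1<\dots<r_u$ the proper upper record values, and put $r_k=1$ for $k<-\ell$ and $r_k=n$ for $k>u$. The $j$th initial rank is $i_j=\#\{k\le j:\pi_{nk}\le\pi_{nj}\}$. A sequence $(\pi_n)_{n\ge1}$ of permutations of $\{1,\dots,n\}$ is coherent if, for all $m\le n$, $\pi_n$ and $\pi_m$ determine the same order on the positions $1,\dots,m$; it is then determined by its initial ranks $i_1,i_2,\dots$, and $\pi_n$ by $i_1,\dots,i_n$. Let $\alpha_k$ $(k\in\mathbb Z)$, $\theta$, $\zeta$ be real parameters in the principal domain, that is, $$1-\alpha_k>0\ (k\ne0),\qquad \theta+\alpha_{-1}+\dots+\alpha_{-\ell}>0\ (\ell\ge0),\qquad \zeta+\alpha_1+\dots+\alpha_u>0\ (u\ge0).$$ Let $P$ be the distribution of a random coherent sequence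 $(\pi_n)$ such that, for every $n\ge1$, given $i_1,\dots,i_n$ (with $(r_k)$, $\ell$, $u$ those of $\pi_n$), $$i_{n+1}=\begin{cases}1&\text{w.p. }\dfrac{\theta+\alpha_{-1}+\dots+\alpha_{-\ell}}{\theta+\zeta+n-1},\\[2mm] r&\text{w.p. }\dfrac{1-\alpha_{k-1}/(r_k-r_{k-1})}{\theta+\zeta+n-1}\quad\text{for } r_{k-1}<r\le r_k,\ k\le0,\\[2mm] r&\text{w.p. }\dfrac{1-\alpha_{k}/(r_k-r_{k-1})}{\theta+\zeta+n-1}\quad\text{for } r_{k-1}<r\le r_k,\ k>0,\\[2mm] n+1&\text{w.p. }\dfrac{\zeta+\alpha_1+\dots+\alpha_u}{\theta+\zeta+n-1}.\end{cases}$$ Then there are random variables $\rho_k$ $(k\in\mathbb Z)$ such that, almost surely under $P$, for the record values $r_k=r_k(\pi_n)$, $$\frac{r_k}{n}\to\rho_k\quad(n\to\infty)\qquad\text{for all }k\in\mathbb Z.$$ The distribution of $\rho_0$ is beta$(\theta,\zeta)$. Given $\rho_0$, the sequences $(\rho_k,\,k<0)$ and $(\rho_k,\,k>0)$ are independent, and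 almost surely $$\rho_k=\rho_0\,T_kT_{k+1}\cdots T_{-1}\ (k<0),\qquad \rho_k=1-(1-\rho_0)Z_1Z_2\cdots Z_k\ (k>0),$$ where $T_k$ is beta$(\theta+\alpha_{-1}+\alpha_{-2}+\dots+\alpha_{k},\,1-\alpha_k)$ for $k<0$, $Z_k$ is beta$(\zeta+\alpha_1+\dots+\alpha_k,\,1-\alpha_k)$ for $k>0$, and the variables $\rho_0$, $T_k$ $(k<0)$ and $Z_k$ $(k>0)$ are all independent. -/

import Mathlib

open MeasureTheory ProbabilityTheory Filter Topology

namespace PolyaRecords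

/-! Permutations of `{1, …, n}` in one-row notation are elements of `Equiv.Perm (Fin n)`; the
position `j : Fin n` stands for the time `j + 1`, and the entry at that position is `σ j + 1`. -/

/-- The entry of `σ` at position `j`, as an element of `{1, …, n}`. -/
def entry {n : ℕ} (σ : Equiv.Perm (Fin n)) (j : Fin n) : ℕ := (σ j : ℕ) + 1

/-- The initial rank of the entry at position `j`: its rank among the entries up to position `j`
(rank one is the smallest, so rank `1` means minimum so far and top rank means maximum so far). -/
def initialRank {n : ℕ} (σ : Equiv.Perm (Fin n)) (j : Fin n) : ℕ :=
  (Finset.univ.filter fun i : Fin n => i ≤ j ∧ σ i ≤ σ j).card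

/-- The entry at position `j` is a lower record: it is the minimum of the entries up to `j`. -/
def IsLowerRecord {n : ℕ} (σ : Equiv.Perm (Fin n)) (j : Fin n) : Prop := ∀ i ≤ j, σ j ≤ σ i

/-- The entry at position `j` is an upper record: it is the maximum of the entries up to `j`. -/
def IsUpperRecord {n : ℕ} (σ : Equiv.Perm (Fin n)) (j : Fin n) : Prop := ∀ i ≤ j, σ i ≤ σ j

instance {n : ℕ} (σ : Equiv.Perm (Fin n)) : DecidablePred (IsLowerRecord σ) :=
  fun j => inferInstanceAs (Decidable (∀ i ≤ j, σ j ≤ σ i))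

instance {n : ℕ} (σ : Equiv.Perm (Fin n)) : DecidablePred (IsUpperRecord σ) :=
  fun j => inferInstanceAs (Decidable (∀ i ≤ j, σ i ≤ σ j))

/-- The values of the proper lower records (the first entry is not proper). -/
def lowerRecordValues {n : ℕ} (σ : Equiv.Perm (Fin n)) : Finset ℕ :=
  (Finset.univ.filter fun j : Fin n => 0 < (j : ℕ) ∧ IsLowerRecord σ j).image (entry σ)

/-- The values of the proper upper records (the first entry is not proper). -/
def upperRecordValues {n : ℕ} (σ : Equiv.Perm (Fin n)) : Finset ℕ :=
  (Finset.univ.filter fun j : Fin n => 0 < (j : ℕ) ∧ IsUpperRecord σ j).image (entry σ)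

/-- The number `ℓ` of proper lower records. -/
def lowerCount {n : ℕ} (σ : Equiv.Perm (Fin n)) : ℕ := (lowerRecordValues σ).card

/-- The number `u` of proper upper records. -/
def upperCount {n : ℕ} (σ : Equiv.Perm (Fin n)) : ℕ := (upperRecordValues σ).card

/-- The center: the first entry (`0` for the empty permutation). -/
def center {n : ℕ} (σ : Equiv.Perm (Fin n)) : ℕ :=
  if h : 0 < n then entry σ ⟨0, h⟩ else 0

/-- The two-sided nondecreasing sequence of record values `(r_k)`, `k ∈ ℤ`: `r_0` is the center,
`r_1 < … < r_u` are the proper upper record values, `r_{-ℓ} < … < r_{-1}` are the proper lower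
record values, and the sequence is padded by `r_k = 1` for `k < -ℓ` and `r_k = n` for `k > u`.
Here `Int.negSucc k` is `-(k + 1)`. -/
def recordValue {n : ℕ} (σ : Equiv.Perm (Fin n)) : ℤ → ℕ
  | Int.ofNat 0 => center σ
  | Int.ofNat (k + 1) => ((upperRecordValues σ).sort (· ≤ ·)).getD k n
  | Int.negSucc k => ((lowerRecordValues σ).sort (· ≥ ·)).getD k 1

/-- Coherence of a sequence of permutations: `π m` and `π n` determine the same order on the
first `m` positions whenever `m ≤ n`. -/
def Coherent (π : ∀ n : ℕ, Equiv.Perm (Fin n)) : Prop :=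
  ∀ (m n : ℕ) (h : m ≤ n) (i j : Fin m),
    π n (Fin.castLE h i) < π n (Fin.castLE h j) ↔ π m i < π m j

/-- `θ + α_{-1} + … + α_{-ℓ}`. -/
noncomputable def lowerSum (α : ℤ → ℝ) (θ : ℝ) (l : ℕ) : ℝ := θ + ∑ j ∈ Finset.Icc (-(l : ℤ)) (-1), α j

/-- `ζ + α_1 + … + α_u`. -/
noncomputable def upperSum (α : ℤ → ℝ) (ζ : ℝ) (u : ℕ) : ℝ := ζ + ∑ j ∈ Finset.Icc (1 : ℤ) u, α j

/-- The principal domain of parameters. The cases `l = 0` and `u = 0` say `θ > 0` and `ζ > 0`. -/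
structure PrincipalDomain (α : ℤ → ℝ) (θ ζ : ℝ) : Prop where
  alpha_lt_one : ∀ k : ℤ, k ≠ 0 → 0 < 1 - α k
  lower_pos : ∀ l : ℕ, 0 < lowerSum α θ l
  upper_pos : ∀ u : ℕ, 0 < upperSum α ζ u

/-- The event that the `n`-th permutation is `σ` and the next initial rank `i_{n+1}` is `r`. -/
def stepEvent {Ω : Type*} (π : ∀ n : ℕ, Ω → Equiv.Perm (Fin n)) {n : ℕ}
    (σ : Equiv.Perm (Fin n)) (r : ℕ) : Set Ω :=
  {ω | π n ω = σ ∧ initialRank (π (n + 1) ω) (Fin.last n) = r}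

/-- A random coherent sequence of permutations whose initial ranks follow the multiparameter
Pólya urn: given `π n = σ`, which is the same as giving the initial ranks `i_1, …, i_n`, the next
initial rank `i_{n+1}` takes its values in `{1, …, n + 1}` with the stated probabilities.
Conditional probabilities are written as
`P (π n = σ, i_{n+1} = r) = P (π n = σ) * probability`. -/
structure IsPolyaRecordSequence {Ω : Type*} [MeasurableSpace Ω] (P : Measure Ω)
    (π : ∀ n : ℕ, Ω → Equiv.Perm (Fin n)) (α : ℤ → ℝ) (θ ζ : ℝ) : Prop where
  measurableSet_eq : ∀ (n : ℕ) (σ : Equiv.Perm (Fin n)), MeasurableSet {ω | π n ω = σ}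
  coherent : ∀ ω, Coherent fun n => π n ω
  /-- A new lower record. -/
  prob_lower_record : ∀ (n : ℕ), 1 ≤ n → ∀ σ : Equiv.Perm (Fin n),
    P.real (stepEvent π σ 1) =
      P.real {ω | π n ω = σ} * (lowerSum α θ (lowerCount σ) / (θ + ζ + n - 1))
  /-- A new element between consecutive records `r_{k-1}` and `r_k` at or below the center: the
  weight `r_k - r_{k-1} - α_{k-1}` is shared equally by the `r_k - r_{k-1}` possible ranks. -/
  prob_below_center : ∀ (n : ℕ), 1 ≤ n → ∀ (σ : Equiv.Perm (Fin n)) (k : ℤ) (r : ℕ), k ≤ 0 →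
    recordValue σ (k - 1) < r → r ≤ recordValue σ k →
    P.real (stepEvent π σ r) =
      P.real {ω | π n ω = σ} *
        ((1 - α (k - 1) / ((recordValue σ k : ℝ) - recordValue σ (k - 1))) / (θ + ζ + n - 1))
  /-- A new element between consecutive records `r_{k-1}` and `r_k` at or above the center. -/
  prob_above_center : ∀ (n : ℕ), 1 ≤ n → ∀ (σ : Equiv.Perm (Fin n)) (k : ℤ) (r : ℕ), 0 < k →
    recordValue σ (k - 1) < r → r ≤ recordValue σ k →
    P.real (stepEvent π σ r) =
      P.real {ω | π n ω = σ} *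
        ((1 - α k / ((recordValue σ k : ℝ) - recordValue σ (k - 1))) / (θ + ζ + n - 1))
  /-- A new upper record. -/
  prob_upper_record : ∀ (n : ℕ), 1 ≤ n → ∀ σ : Equiv.Perm (Fin n),
    P.real (stepEvent π σ (n + 1)) =
      P.real {ω | π n ω = σ} * (upperSum α ζ (upperCount σ) / (θ + ζ + n - 1))

/-- `Y` and `Y'` are conditionally independent given (the σ-algebra generated by) `X`, on an
arbitrary probability space. On a standard Borel space this is `ProbabilityTheory.CondIndepFun`. -/
def CondIndepGiven {Ω β γ δ : Type*} [MeasurableSpace Ω] [mβ : MeasurableSpace β]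
    [MeasurableSpace γ] [MeasurableSpace δ] (P : Measure Ω)
    (X : Ω → β) (Y : Ω → γ) (Y' : Ω → δ) : Prop :=
  ∀ (A : Set γ) (B : Set δ), MeasurableSet A → MeasurableSet B →
    P⟦Y ⁻¹' A ∩ Y' ⁻¹' B | mβ.comap X⟧ =ᵐ[P]
      fun ω => (P⟦Y ⁻¹' A | mβ.comap X⟧) ω * (P⟦Y' ⁻¹' B | mβ.comap X⟧) ω

end PolyaRecords

namespace PolyaRecords

/-! ### Sorted lists of record values -/

/-! Write A_k = θ + α_{-1} + … + α_{-k}. Once k lower records exist, the next rank is at most r_{-k}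
with probability W_k / (θ + ζ + n - 1), where W_k = A_k + r_{-k} - 1 (`sum_stepEvent`). Given this,
it is at most r_{-k-1} with probability W_{k+1} / W_k, and each hit adds one to the weight: a
two-colour Pólya urn, run at the times when the rank is at most r_{-k}. The urn is born with the
(k+1)-st record, when r_{-k-1} = 1 and r_{-k} = 2, so its initial weights are A_{k+1} and A_k + 1 -
A_{k+1} = 1 - α_{-k-1}, and its proportion has a beta limit with these parameters. Reversing the
values gives the upper side; the outermost urn, started from θ and ζ, weighs the two sides of the
center against each other. The scaled records are telescoping products of urn proportions, which is
the stick-breaking formula.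

Independence comes from mixed moments. The rising factorial ratio `urnRatio` is harmonic for a Pólya
urn and tends to a power of the limit proportion. As the urns are nested, products of such ratios
over finitely many urns are bounded martingales (`sum_mul_urnProduct`, `martingale_urnValue`). The
mean, read off at time one, is a product of beta moments, and the limit is a monomial in the limit
proportions (`integral_prod_limit`). By Stone-Weierstrass, moments determine measures on cubes
(`ext_of_moments`), so the limits are independent beta variables.

Every urn does become active: with exactly k records so far, a new one has probability of order 1/n,
and the harmonic series diverges (`tendsto_lowerCount`). -/

theorem sort_ge_eq {S : Finset ℕ} {l : List ℕ} (hl : l.Pairwise (· > ·))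
    (h : ∀ x, x ∈ l ↔ x ∈ S) : S.sort (· ≥ ·) = l :=
  (S.sortedGT_sort.pairwise).eq_of_mem_iff hl fun x => by simp [h]

/-- The reversal `σ_j ↦ n + 1 - σ_j` of the values of a permutation. -/
def reversal {n : ℕ} (σ : Equiv.Perm (Fin n)) : Equiv.Perm (Fin n) := σ.trans Fin.revPerm

@[simp] theorem reversal_apply {n : ℕ} (σ : Equiv.Perm (Fin n)) (j : Fin n) :
    reversal σ j = Fin.rev (σ j) := rfl

@[simp] theorem reversal_reversal {n : ℕ} (σ : Equiv.Perm (Fin n)) :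
    reversal (reversal σ) = σ := by
  ext j; simp

theorem entry_reversal {n : ℕ} (σ : Equiv.Perm (Fin n)) (j : Fin n) :
    entry (reversal σ) j = n + 1 - entry σ j := by
  have := (σ j).isLt
  simp only [entry, reversal_apply, Fin.val_rev]
  omega

theorem entry_pos {n : ℕ} (σ : Equiv.Perm (Fin n)) (j : Fin n) : 0 < entry σ j := Nat.succ_pos _

theorem entry_le {n : ℕ} (σ : Equiv.Perm (Fin n)) (j : Fin n) : entry σ j ≤ n := (σ j).isLt

theorem isLowerRecord_reversal {n : ℕ} (σ : Equiv.Perm (Fin n)) (j : Fin n) :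
    IsLowerRecord (reversal σ) j ↔ IsUpperRecord σ j := by
  simp [IsLowerRecord, IsUpperRecord]

theorem mem_lowerRecordValues {n : ℕ} {σ : Equiv.Perm (Fin n)} {x : ℕ} :
    x ∈ lowerRecordValues σ ↔ ∃ j : Fin n, (0 < (j : ℕ) ∧ IsLowerRecord σ j) ∧ entry σ j = x := by
  simp [lowerRecordValues]

theorem mem_upperRecordValues {n : ℕ} {σ : Equiv.Perm (Fin n)} {x : ℕ} :
    x ∈ upperRecordValues σ ↔ ∃ j : Fin n, (0 < (j : ℕ) ∧ IsUpperRecord σ j) ∧ entry σ j = x := by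
  simp [upperRecordValues]

theorem upperRecordValues_le {n : ℕ} {σ : Equiv.Perm (Fin n)} {x : ℕ}
    (h : x ∈ upperRecordValues σ) : x ≤ n := by
  obtain ⟨j, -, rfl⟩ := mem_upperRecordValues.1 h
  exact entry_le σ j

/-- Both lists run outward from the center, so the decreasing map x ↦ n + 1 - x carries one to the
other without reversing the order of its terms. -/
theorem sort_lowerRecordValues_reversal {n : ℕ} (σ : Equiv.Perm (Fin n)) :
    (lowerRecordValues (reversal σ)).sort (· ≥ ·) =
      ((upperRecordValues σ).sort (· ≤ ·)).map fun x => n + 1 - x := by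
  refine sort_ge_eq ?_ fun x => ?_
  · rw [List.pairwise_map]
    refine List.Pairwise.imp_of_mem ?_ (upperRecordValues σ).sortedLT_sort.pairwise
    intro a b ha hb hab
    have := upperRecordValues_le ((Finset.mem_sort _).1 ha)
    omega
  · simp only [List.mem_map, Finset.mem_sort, mem_lowerRecordValues, mem_upperRecordValues,
      isLowerRecord_reversal, entry_reversal]
    constructor
    · rintro ⟨_, ⟨j, hj, rfl⟩, rfl⟩
      exact ⟨j, hj, rfl⟩
    · rintro ⟨j, hj, rfl⟩
      exact ⟨_, ⟨j, hj, rfl⟩, rfl⟩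

theorem lowerCount_reversal {n : ℕ} (σ : Equiv.Perm (Fin n)) :
    lowerCount (reversal σ) = upperCount σ := by
  have := congrArg List.length (sort_lowerRecordValues_reversal σ)
  simpa [lowerCount, upperCount] using this

theorem upperCount_reversal {n : ℕ} (σ : Equiv.Perm (Fin n)) :
    upperCount (reversal σ) = lowerCount σ := by
  rw [← lowerCount_reversal, reversal_reversal]

theorem recordValue_negSucc {n : ℕ} (σ : Equiv.Perm (Fin n)) (k : ℕ) :
    recordValue σ (-((k + 1 : ℕ) : ℤ)) = ((lowerRecordValues σ).sort (· ≥ ·)).getD k 1 := rfl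

theorem recordValue_succ {n : ℕ} (σ : Equiv.Perm (Fin n)) (k : ℕ) :
    recordValue σ ((k + 1 : ℕ) : ℤ) = ((upperRecordValues σ).sort (· ≤ ·)).getD k n := rfl

theorem recordValue_zero {n : ℕ} (σ : Equiv.Perm (Fin n)) :
    recordValue σ 0 = center σ := rfl

theorem recordValue_reversal_neg {n : ℕ} (hn : 1 ≤ n) (σ : Equiv.Perm (Fin n)) (k : ℕ) :
    recordValue (reversal σ) (-(k : ℤ)) = n + 1 - recordValue σ k := by
  cases k with
  | zero =>
    simp only [Nat.cast_zero, neg_zero, recordValue_zero, center]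
    rw [dif_pos (by omega), dif_pos (by omega), entry_reversal]
  | succ k =>
    rw [recordValue_negSucc, recordValue_succ, sort_lowerRecordValues_reversal]
    have := List.getD_map (f := fun x => n + 1 - x) (l := (upperRecordValues σ).sort (· ≤ ·))
      (d := n) (n := k)
    rwa [show n + 1 - n = 1 by omega] at this

theorem recordValue_nat_le {n : ℕ} (σ : Equiv.Perm (Fin n)) (k : ℕ) : recordValue σ k ≤ n := by
  cases k with
  | zero =>
    simp only [Nat.cast_zero, recordValue_zero, center]
    split_ifs
    · exact entry_le _ _
    · omega
  | succ k =>
    rw [recordValue_succ]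
    by_cases h : k < ((upperRecordValues σ).sort (· ≤ ·)).length
    · rw [List.getD_eq_getElem _ _ h]
      exact upperRecordValues_le ((Finset.mem_sort _).1 (List.getElem_mem h))
    · rw [List.getD_eq_default _ _ (not_lt.1 h)]

theorem recordValue_nat {n : ℕ} (hn : 1 ≤ n) (σ : Equiv.Perm (Fin n)) (k : ℕ) :
    recordValue σ k = n + 1 - recordValue (reversal σ) (-(k : ℤ)) := by
  have := recordValue_reversal_neg hn σ k
  have := recordValue_nat_le σ k
  omega

theorem recordValue_reversal {n : ℕ} (hn : 1 ≤ n) (σ : Equiv.Perm (Fin n)) (k : ℤ) :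
    recordValue (reversal σ) k = n + 1 - recordValue σ (-k) := by
  obtain ⟨k, rfl | rfl⟩ := k.eq_nat_or_neg
  · simpa using recordValue_nat hn (reversal σ) k
  · simpa using recordValue_reversal_neg hn σ k

theorem recordValue_le {n : ℕ} (hn : 1 ≤ n) (σ : Equiv.Perm (Fin n)) (k : ℤ) :
    recordValue σ k ≤ n := by
  obtain ⟨k, rfl | rfl⟩ := k.eq_nat_or_neg
  · exact recordValue_nat_le σ k
  · cases k with
    | zero => exact recordValue_nat_le σ 0
    | succ k =>
      rw [recordValue_negSucc]
      by_cases h : k < ((lowerRecordValues σ).sort (· ≥ ·)).length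
      · rw [List.getD_eq_getElem _ _ h]
        obtain ⟨j, -, hj⟩ := mem_lowerRecordValues.1 ((Finset.mem_sort _).1 (List.getElem_mem h))
        rw [← hj]
        exact entry_le _ _
      · rwa [List.getD_eq_default _ _ (not_lt.1 h)]

theorem recordValue_pos {n : ℕ} (hn : 1 ≤ n) (σ : Equiv.Perm (Fin n)) (k : ℤ) :
    1 ≤ recordValue σ k := by
  have h1 := recordValue_reversal hn σ (-k)
  have h2 := recordValue_le hn (reversal σ) (-k)
  rw [neg_neg] at h1
  omega

/-! ### Extending a permutation by one entry -/

/-- `τ` extends `σ` by one entry. -/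
def Extends {n : ℕ} (σ : Equiv.Perm (Fin n)) (τ : Equiv.Perm (Fin (n + 1))) : Prop :=
  ∀ i j : Fin n, τ i.castSucc < τ j.castSucc ↔ σ i < σ j

/-- A strictly increasing map on `Fin n` is determined by its range; here both ranges consist of all
values except that of the last entry. -/
theorem Extends.apply_castSucc {n : ℕ} {σ : Equiv.Perm (Fin n)} {τ : Equiv.Perm (Fin (n + 1))}
    (h : Extends σ τ) (i : Fin n) : τ i.castSucc = (τ (Fin.last n)).succAbove (σ i) := by
  have key : (fun x => τ (σ.symm x).castSucc) = (τ (Fin.last n)).succAbove := by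
    refine (StrictMono.range_inj (fun x y hxy => ?_) (Fin.strictMono_succAbove _)).1 ?_
    · rw [h]; simpa using hxy
    · rw [Fin.range_succAbove]
      ext y
      simp only [Set.mem_range, Set.mem_compl_iff, Set.mem_singleton_iff]
      constructor
      · rintro ⟨x, rfl⟩ hx
        exact (Fin.castSucc_lt_last _).ne (τ.injective hx)
      · intro hy
        obtain ⟨z, rfl⟩ := τ.surjective y
        rcases Fin.eq_castSucc_or_eq_last z with ⟨j, rfl⟩ | rfl
        · exact ⟨σ j, by simp⟩
        · exact absurd rfl hy
  simpa using congrFun key (σ i)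

theorem initialRank_last {n : ℕ} (τ : Equiv.Perm (Fin (n + 1))) :
    initialRank τ (Fin.last n) = entry τ (Fin.last n) := by
  have : (Finset.univ.filter fun i : Fin (n + 1) => i ≤ Fin.last n ∧ τ i ≤ τ (Fin.last n)) =
      (Finset.Iic (τ (Fin.last n))).map τ.symm.toEmbedding := by
    ext i
    simp [Fin.le_last]
  rw [initialRank, this, Finset.card_map, Fin.card_Iic, entry]

/-- The effect on an old entry of inserting a new entry of rank `r`. -/
def shift (r x : ℕ) : ℕ := if r ≤ x then x + 1 else x

theorem shift_strictMono (r : ℕ) : StrictMono (shift r) := by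
  intro x y h
  unfold shift
  split_ifs <;> omega

theorem Extends.entry_castSucc {n : ℕ} {σ : Equiv.Perm (Fin n)} {τ : Equiv.Perm (Fin (n + 1))}
    (h : Extends σ τ) (i : Fin n) :
    entry τ i.castSucc = shift (entry τ (Fin.last n)) (entry σ i) := by
  rw [entry, h.apply_castSucc, entry, entry, shift]
  by_cases h' : (σ i).castSucc < τ (Fin.last n)
  · rw [Fin.succAbove_of_castSucc_lt _ _ h']
    have : (σ i : ℕ) < τ (Fin.last n) := h'
    rw [if_neg (by omega)]
    rfl
  · rw [Fin.succAbove_of_le_castSucc _ _ (not_lt.1 h')]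
    have : ¬ (σ i : ℕ) < τ (Fin.last n) := h'
    rw [if_pos (by omega)]
    rfl

theorem Extends.isLowerRecord_castSucc {n : ℕ} {σ : Equiv.Perm (Fin n)}
    {τ : Equiv.Perm (Fin (n + 1))} (h : Extends σ τ) (j : Fin n) :
    IsLowerRecord τ j.castSucc ↔ IsLowerRecord σ j := by
  constructor
  · intro H i hi
    have := H i.castSucc (by simpa using hi)
    rw [← not_lt, h] at this
    exact not_lt.1 this
  · intro H i hi
    rcases Fin.eq_castSucc_or_eq_last i with ⟨i, rfl⟩ | rfl
    · rw [← not_lt, h]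
      exact not_lt.2 (H i (by simpa using hi))
    · exact absurd (Fin.castSucc_lt_last j) (not_lt.2 hi)

theorem isLowerRecord_last {n : ℕ} (τ : Equiv.Perm (Fin (n + 1))) :
    IsLowerRecord τ (Fin.last n) ↔ entry τ (Fin.last n) = 1 := by
  constructor
  · intro H
    have := H (τ.symm 0) (Fin.le_last _)
    simp only [Equiv.apply_symm_apply] at this
    rw [entry, le_antisymm this (Fin.zero_le _)]
    rfl
  · intro H i _
    have : (τ (Fin.last n) : ℕ) = 0 := by
      rw [entry] at H; omega
    exact Fin.le_def.2 (by omega)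

/-- Old records survive with shifted values. The new entry is a lower record only if its rank is 1,
and then it is the smallest and closes the decreasing list; `hn` makes this record proper. -/
theorem Extends.sort_lowerRecordValues {n : ℕ} (hn : 1 ≤ n) {σ : Equiv.Perm (Fin n)}
    {τ : Equiv.Perm (Fin (n + 1))} (h : Extends σ τ) :
    (lowerRecordValues τ).sort (· ≥ ·) =
      ((lowerRecordValues σ).sort (· ≥ ·)).map (shift (entry τ (Fin.last n))) ++
        if entry τ (Fin.last n) = 1 then [1] else [] := by
  set r := entry τ (Fin.last n) with hr
  refine sort_ge_eq ?_ fun x => ?_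
  · rw [List.pairwise_append]
    refine ⟨?_, ?_, ?_⟩
    · rw [List.pairwise_map]
      exact (lowerRecordValues σ).sortedGT_sort.pairwise.imp fun hab => shift_strictMono _ hab
    · split_ifs <;> simp
    · intro a ha b hb
      split_ifs at hb with h1
      · obtain ⟨y, hy, rfl⟩ := List.mem_map.1 ha
        obtain ⟨j, -, rfl⟩ := mem_lowerRecordValues.1 ((Finset.mem_sort _).1 hy)
        have := entry_pos σ j
        rw [List.mem_singleton.1 hb, h1, shift, if_pos (by omega)]
        omega
      · simp at hb
  · simp only [List.mem_append, List.mem_map, Finset.mem_sort, mem_lowerRecordValues]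
    constructor
    · rintro (⟨_, ⟨j, ⟨hj0, hj⟩, rfl⟩, rfl⟩ | hx)
      · exact ⟨j.castSucc, ⟨by simpa using hj0, h.isLowerRecord_castSucc j |>.2 hj⟩,
          h.entry_castSucc j⟩
      · split_ifs at hx with h1
        · exact ⟨Fin.last n, ⟨by simpa using Nat.pos_of_ne_zero (by omega), (isLowerRecord_last τ).2 h1⟩, by
            rw [List.mem_singleton.1 hx, ← hr, h1]⟩
        · simp at hx
    · rintro ⟨j, ⟨hj0, hj⟩, rfl⟩
      rcases Fin.eq_castSucc_or_eq_last j with ⟨j, rfl⟩ | rfl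
      · exact Or.inl ⟨_, ⟨j, ⟨by simpa using hj0, (h.isLowerRecord_castSucc j).1 hj⟩, rfl⟩,
          (h.entry_castSucc j).symm⟩
      · have h1 := (isLowerRecord_last τ).1 hj
        rw [← hr] at h1 ⊢
        simp [h1]

/-! ### The lower side of a permutation and its dynamics -/

/-- The number of proper lower records, together with the sequence `r_0, r_{-1}, r_{-2}, …`. -/
def lowerState {n : ℕ} (σ : Equiv.Perm (Fin n)) : ℕ × (ℕ → ℕ) :=
  (lowerCount σ, fun k => recordValue σ (-(k : ℤ)))

/-- The effect on `lowerState` of a new entry of rank `r`. -/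
def sideStep (r : ℕ) (s : ℕ × (ℕ → ℕ)) : ℕ × (ℕ → ℕ) :=
  (if r = 1 then s.1 + 1 else s.1, fun k => if k ≤ s.1 then shift r (s.2 k) else 1)

/-- The cutoff at the record count in `sideStep` protects the padding: under a new rank 1 the padded
values must stay 1, and the first of them becomes the value of the new record. -/
theorem Extends.lowerState {n : ℕ} (hn : 1 ≤ n) {σ : Equiv.Perm (Fin n)}
    {τ : Equiv.Perm (Fin (n + 1))} (h : Extends σ τ) :
    lowerState τ = sideStep (entry τ (Fin.last n)) (lowerState σ) := by
  have hs := h.sort_lowerRecordValues hn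
  refine Prod.ext ?_ (funext fun k => ?_)
  · have := congrArg List.length hs
    simp only [Finset.length_sort, List.length_append, List.length_map] at this
    simp only [PolyaRecords.lowerState, sideStep, lowerCount, this]
    split_ifs <;> simp
  · cases k with
    | zero =>
      simp only [PolyaRecords.lowerState, sideStep, Nat.cast_zero, neg_zero, recordValue_zero,
        center, zero_le, if_true]
      rw [dif_pos (by omega), dif_pos (by omega)]
      exact h.entry_castSucc ⟨0, by omega⟩
    | succ k =>
      change recordValue τ (-((k + 1 : ℕ) : ℤ)) = if k + 1 ≤ lowerCount σ then
        shift (entry τ (Fin.last n)) (recordValue σ (-((k + 1 : ℕ) : ℤ))) else 1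
      rw [recordValue_negSucc, recordValue_negSucc, hs]
      have hl : lowerCount σ = ((lowerRecordValues σ).sort (· ≥ ·)).length := by simp [lowerCount]
      set l := (lowerRecordValues σ).sort (· ≥ ·)
      by_cases hk : k < l.length
      · rw [if_pos (show k + 1 ≤ lowerCount σ by omega), List.getD_eq_getElem _ _ hk, List.getD_append _ _ _ _ (by simpa),
          List.getD_eq_getElem _ _ (by simpa), List.getElem_map]
      · rw [if_neg (show ¬ k + 1 ≤ lowerCount σ by omega), List.getD_append_right _ _ _ _ (by simpa using hk)]
        split_ifs
        · cases h : k - (List.map (shift (entry τ (Fin.last n))) l).length <;> simp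
        · simp

theorem lowerState_one (σ : Equiv.Perm (Fin 1)) : lowerState σ = (0, fun _ => 1) := by
  have h0 : lowerRecordValues σ = ∅ := by
    refine Finset.eq_empty_of_forall_notMem fun x hx => ?_
    obtain ⟨j, ⟨hj, -⟩, -⟩ := mem_lowerRecordValues.1 hx
    omega
  refine Prod.ext ?_ (funext fun k => ?_)
  · simp [lowerState, lowerCount, h0]
  · have h1 := recordValue_pos le_rfl σ (-(k : ℤ))
    have h2 := recordValue_le le_rfl σ (-(k : ℤ))
    simp only [lowerState]
    omega

/-- The structural constraints on the state of a side: the levels decrease strictly to `1`, which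
is reached at the index that counts the records. -/
structure IsSideState (s : ℕ × (ℕ → ℕ)) : Prop where
  lt : ∀ k < s.1, s.2 (k + 1) < s.2 k
  eq_one : ∀ k, s.1 ≤ k → s.2 k = 1

theorem isSideState_initial : IsSideState (0, fun _ => 1) :=
  ⟨fun k hk => absurd hk (Nat.not_lt_zero k), fun _ _ => rfl⟩

theorem IsSideState.sideStep {s : ℕ × (ℕ → ℕ)} (h : IsSideState s) {r : ℕ} (hr : 1 ≤ r) :
    IsSideState (sideStep r s) := by
  constructor
  · intro k hk
    simp only [PolyaRecords.sideStep] at hk ⊢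
    rcases lt_trichotomy k s.1 with h1 | rfl | h1
    · rw [if_pos (by omega), if_pos (by omega)]
      exact shift_strictMono r (h.lt k h1)
    · rw [if_neg (by omega), if_pos le_rfl, h.eq_one _ le_rfl, shift]
      split_ifs at hk with h2
      · rw [if_pos (by omega)]; omega
      · omega
    · split_ifs at hk <;> omega
  · intro k hk
    simp only [PolyaRecords.sideStep] at hk ⊢
    split_ifs with h1
    · split_ifs at hk
      · omega
      · rw [h.eq_one k hk, shift, if_neg (by omega)]
    · rfl

theorem IsSideState.one_le {s : ℕ × (ℕ → ℕ)} (h : IsSideState s) (k : ℕ) : 1 ≤ s.2 k := by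
  rcases le_or_gt s.1 k with h1 | h1
  · exact (h.eq_one k h1).ge
  · exact (Nat.zero_le _).trans_lt (h.lt k h1)

theorem IsSideState.antitone {s : ℕ × (ℕ → ℕ)} (h : IsSideState s) : Antitone s.2 := by
  refine antitone_nat_of_succ_le fun k => ?_
  rcases le_or_gt s.1 k with h1 | h1
  · rw [h.eq_one k h1, h.eq_one (k + 1) (by omega)]
  · exact (h.lt k h1).le

/-- Each level drops by at least one towards the value 1 at index `s.1`. Hence every fixed level
tends to infinity with the number of records. -/
theorem IsSideState.sub_lt {s : ℕ × (ℕ → ℕ)} (h : IsSideState s) (k : ℕ) : s.1 - k < s.2 k := by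
  obtain ⟨d, hd⟩ : ∃ d, d = s.1 - k := ⟨_, rfl⟩
  induction d generalizing k with
  | zero => rw [← hd]; exact h.one_le k
  | succ d ih =>
    have h1 := ih (k + 1) (by omega)
    have h2 := h.lt k (by omega)
    omega

/-- This decouples the two sides: an entry placed beyond the center leaves this side unchanged. -/
theorem IsSideState.sideStep_eq_self {s : ℕ × (ℕ → ℕ)} (h : IsSideState s) {r : ℕ}
    (hr : s.2 0 < r) : PolyaRecords.sideStep r s = s := by
  have h1 := h.one_le 0
  refine Prod.ext ?_ (funext fun k => ?_)
  · simp only [PolyaRecords.sideStep]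
    rw [if_neg (by omega)]
  · simp only [PolyaRecords.sideStep]
    split_ifs with hk
    · have := h.antitone (Nat.zero_le k)
      rw [shift, if_neg (by omega)]
    · exact (h.eq_one k (by omega)).symm

/-! ### Coherent sequences: reachable states, reversal, determination of the past. -/

theorem Coherent.extends {π : ∀ n : ℕ, Equiv.Perm (Fin n)} (h : Coherent π) (n : ℕ) :
    Extends (π n) (π (n + 1)) := fun i j => h n (n + 1) (Nat.le_succ n) i j

theorem Coherent.isSideState {π : ∀ n : ℕ, Equiv.Perm (Fin n)} (h : Coherent π) {n : ℕ}
    (hn : 1 ≤ n) : IsSideState (lowerState (π n)) := by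
  induction n, hn using Nat.le_induction with
  | base => rw [lowerState_one]; exact isSideState_initial
  | succ n hn ih =>
    rw [(h.extends n).lowerState hn]
    exact ih.sideStep (entry_pos _ _)

theorem Coherent.reversal {π : ∀ n : ℕ, Equiv.Perm (Fin n)} (h : Coherent π) :
    Coherent fun n => reversal (π n) := by
  intro m n hmn i j
  simp [h m n hmn]

/-- The permutation at a later time determines the earlier ones, since the only increasing bijection
of `Fin m` is the identity. This makes the σ-algebras of the process a filtration. -/
theorem Coherent.eq_of_le {π π' : ∀ n : ℕ, Equiv.Perm (Fin n)} (h : Coherent π)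
    (h' : Coherent π') {m n : ℕ} (hmn : m ≤ n) (hn : π n = π' n) : π m = π' m := by
  have key : (fun x => π' m ((π m).symm x)) = id := by
    refine (StrictMono.range_inj (fun x y hxy => ?_) strictMono_id).1 ?_
    · rw [← h' m n hmn, ← hn, h m n hmn]
      simpa using hxy
    · simp only [Set.range_id]
      exact ((π m).symm.trans (π' m)).surjective.range_eq
  refine Equiv.ext fun j => ?_
  simpa using (congrFun key (π m j)).symm

end PolyaRecords

namespace PolyaRecords

/-! ### Harmonic functions of a Pólya urn -/

/-- The ratio of rising factorials `x (x + 1) ⋯ (x + a - 1) / (y (y + 1) ⋯ (y + a - 1))`. -/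
noncomputable def urnRatio (a : ℕ) (x y : ℝ) : ℝ := ∏ i ∈ Finset.range a, (x + i) / (y + i)

@[simp] theorem urnRatio_zero (x y : ℝ) : urnRatio 0 x y = 1 := by simp [urnRatio]

@[simp] theorem urnRatio_one (x y : ℝ) : urnRatio 1 x y = x / y := by simp [urnRatio]

theorem urnRatio_succ (a : ℕ) (x y : ℝ) :
    urnRatio (a + 1) x y = urnRatio a x y * ((x + a) / (y + a)) := by
  rw [urnRatio, Finset.prod_range_succ, urnRatio]

/-- Shifting the argument of a rising factorial by one only exchanges its first factor for a new
last one; the next lemma is the same remark for the denominator alone. -/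
theorem mul_urnRatio_add_one (a : ℕ) {x y : ℝ} (hy : 0 < y) :
    x * urnRatio a (x + 1) (y + 1) = y * urnRatio a x y * ((x + a) / (y + a)) := by
  induction a with
  | zero => simp [mul_div_cancel₀ _ hy.ne']
  | succ a ih =>
    rw [urnRatio_succ, ← mul_assoc, ih, urnRatio_succ]
    push_cast
    ring

theorem add_mul_urnRatio (a : ℕ) {x y : ℝ} (hy : 0 < y) :
    (y + a) * urnRatio a x (y + 1) = y * urnRatio a x y := by
  induction a with
  | zero => simp
  | succ a ih =>
    have h1 : y + a ≠ 0 := by positivity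
    have h2 : y + 1 + a ≠ 0 := by positivity
    rw [urnRatio_succ, urnRatio_succ, ← mul_assoc y, ← ih]
    push_cast
    field_simp
    ring

/-- Rising factorial ratios are harmonic for the Pólya urn. -/
theorem urnRatio_harmonic (a : ℕ) {x y : ℝ} (hy : 0 < y) :
    x * urnRatio a (x + 1) (y + 1) + (y - x) * urnRatio a x (y + 1) = y * urnRatio a x y := by
  have h1 : y + a ≠ 0 := by positivity
  have h2 : urnRatio a x (y + 1) = y * urnRatio a x y / (y + a) := by
    rw [← add_mul_urnRatio a hy]; field_simp
  rw [mul_urnRatio_add_one a hy, h2]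
  field_simp
  ring

theorem urnRatio_mem_Icc (a : ℕ) {x y : ℝ} (hx : 0 < x) (hxy : x ≤ y) :
    urnRatio a x y ∈ Set.Icc (0 : ℝ) 1 := by
  have h : ∀ i : ℕ, 0 ≤ (x + i) / (y + i) ∧ (x + i) / (y + i) ≤ 1 := fun i => by
    have : 0 < y := hx.trans_le hxy
    exact ⟨by positivity, (div_le_one (by positivity)).2 (by linarith)⟩
  exact ⟨Finset.prod_nonneg fun i _ => (h i).1,
    Finset.prod_le_one (fun i _ => (h i).1) fun i _ => (h i).2⟩

/-! ### The nested urns on one side of the center -/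

/-- The total weight of the ranks up to the `k`-th level. -/
noncomputable def sideWeight (A : ℕ → ℝ) (s : ℕ × (ℕ → ℕ)) (k : ℕ) : ℝ := A k + s.2 k - 1

/-- The harmonic function of the urn between the levels `k` and `k + 1`. Before the urn becomes
active, its value is that of its initial composition. -/
noncomputable def sideFactor (A : ℕ → ℝ) (a : ℕ) (s : ℕ × (ℕ → ℕ)) (k : ℕ) : ℝ :=
  if k < s.1 then urnRatio a (sideWeight A s (k + 1)) (sideWeight A s k)
  else urnRatio a (A (k + 1)) (A k + 1)

/-- Positivity of the initial compositions of the urns of one side. -/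
structure SideParams (A : ℕ → ℝ) : Prop where
  pos : ∀ k, 0 < A k
  succ_lt : ∀ k, A (k + 1) < A k + 1

variable {A : ℕ → ℝ} {s : ℕ × (ℕ → ℕ)}

theorem SideParams.sideWeight_pos (hA : SideParams A) (hs : IsSideState s) (k : ℕ) :
    0 < sideWeight A s k := by
  have h1 := hA.pos k
  have h2 : (1 : ℝ) ≤ s.2 k := by exact_mod_cast hs.one_le k
  rw [sideWeight]
  linarith

theorem SideParams.sideWeight_succ_le (hA : SideParams A) (hs : IsSideState s) {k : ℕ}
    (hk : k < s.1) : sideWeight A s (k + 1) ≤ sideWeight A s k := by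
  have h1 := hA.succ_lt k
  have h2 : (s.2 (k + 1) : ℝ) + 1 ≤ s.2 k := by exact_mod_cast hs.lt k hk
  rw [sideWeight, sideWeight]
  linarith

theorem SideParams.sideFactor_mem_Icc (hA : SideParams A) (hs : IsSideState s) (a k : ℕ) :
    sideFactor A a s k ∈ Set.Icc (0 : ℝ) 1 := by
  rw [sideFactor]
  split_ifs with h
  · exact urnRatio_mem_Icc _ (hA.sideWeight_pos hs _) (hA.sideWeight_succ_le hs h)
  · exact urnRatio_mem_Icc _ (hA.pos _) (hA.succ_lt k).le

theorem sideWeight_sideStep_of_le {r k : ℕ} (hk : k ≤ s.1) (hr : r ≤ s.2 k) :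
    sideWeight A (sideStep r s) k = sideWeight A s k + 1 := by
  simp only [sideWeight, sideStep, shift, if_pos hk, if_pos hr]
  push_cast
  ring

theorem sideWeight_sideStep_of_lt {r k : ℕ} (hk : k ≤ s.1) (hr : s.2 k < r) :
    sideWeight A (sideStep r s) k = sideWeight A s k := by
  simp only [sideWeight, sideStep, shift, if_pos hk, if_neg (not_le.2 hr)]

/-- The urn k = `s.1` is born at this step, with levels 1 and 2, hence with exactly the weights used
as its placeholder value; the urns beyond it remain dormant. So activation causes no jump in the
martingale. -/
theorem IsSideState.sideFactor_sideStep_one (hs : IsSideState s) (a : ℕ) {k : ℕ} (hk : s.1 ≤ k) :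
    sideFactor A a (PolyaRecords.sideStep 1 s) k = sideFactor A a s k := by
  rcases hk.eq_or_lt with rfl | hk
  · have h1 : sideWeight A (PolyaRecords.sideStep 1 s) (s.1 + 1) = A (s.1 + 1) := by
      simp [sideWeight, PolyaRecords.sideStep]
    have h2 : sideWeight A (PolyaRecords.sideStep 1 s) s.1 = A s.1 + 1 := by
      rw [sideWeight_sideStep_of_le le_rfl (hs.one_le _), sideWeight, hs.eq_one _ le_rfl]
      simp
    rw [sideFactor, sideFactor, if_neg (lt_irrefl _), h1, h2, if_pos]
    simp [PolyaRecords.sideStep]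
  · have h1 : (PolyaRecords.sideStep 1 s).1 = s.1 + 1 := by simp [PolyaRecords.sideStep]
    rw [sideFactor, sideFactor, if_neg (by omega), if_neg (by omega)]

theorem IsSideState.sideFactor_sideStep_of_lt (hs : IsSideState s) (a : ℕ) {r k : ℕ}
    (hr : s.2 k < r) : sideFactor A a (PolyaRecords.sideStep r s) k = sideFactor A a s k := by
  have h1 := hs.one_le k
  have h2 : (PolyaRecords.sideStep r s).1 = s.1 := by
    simp only [PolyaRecords.sideStep]
    rw [if_neg (by omega)]
  rw [sideFactor, sideFactor, h2]
  split_ifs with hk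
  · rw [sideWeight_sideStep_of_lt hk ((hs.lt k hk).trans hr), sideWeight_sideStep_of_lt hk.le hr]
  · rfl

theorem Icc_one_eq_union {m n : ℕ} (h : m ≤ n) :
    Finset.Icc 1 n = Finset.Icc 1 m ∪ Finset.Ioc m n := by
  ext x
  simp only [Finset.mem_Icc, Finset.mem_union, Finset.mem_Ioc]
  omega

theorem sum_Icc_one_add_sum_Ioc {M : Type*} [AddCommMonoid M] (f : ℕ → M) {m n : ℕ} (h : m ≤ n) :
    ∑ r ∈ Finset.Icc 1 n, f r = ∑ r ∈ Finset.Icc 1 m, f r + ∑ r ∈ Finset.Ioc m n, f r := by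
  rw [Icc_one_eq_union h, Finset.sum_union]
  refine Finset.disjoint_left.2 fun x h1 h2 => ?_
  simp only [Finset.mem_Icc, Finset.mem_Ioc] at h1 h2
  omega

/-- The product of the harmonic functions of the nested urns is harmonic. -/
theorem SideParams.sum_mul_prod_sideFactor (hA : SideParams A) (hs : IsSideState s) (a : ℕ → ℕ)
    {w : ℕ → ℝ} {q : ℝ}
    (hw : ∀ k ≤ s.1, ∑ r ∈ Finset.Icc 1 (s.2 k), w r = q * sideWeight A s k) (K : ℕ) {k : ℕ}
    (hk : k ≤ s.1) :
    ∑ r ∈ Finset.Icc 1 (s.2 k), w r * ∏ j ∈ Finset.Ico k K, sideFactor A (a j) (sideStep r s) j =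
      q * sideWeight A s k * ∏ j ∈ Finset.Ico k K, sideFactor A (a j) s j := by
  -- Induction from the innermost level outward; at the level `s.1` the only possible rank is 1.
  induction hk using Nat.decreasingInduction with
  | self =>
    rw [← hw _ le_rfl, hs.eq_one _ le_rfl, Finset.Icc_self, Finset.sum_singleton,
      Finset.sum_singleton]
    congr 1
    exact Finset.prod_congr rfl fun j hj => hs.sideFactor_sideStep_one _ (Finset.mem_Ico.1 hj).1
  | of_succ k hk ih =>
    rcases le_or_gt K k with hK | hK
    · simp only [Finset.Ico_eq_empty_of_le hK, Finset.prod_empty, mul_one]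
      exact hw k hk.le
    have hlt := hs.lt k hk
    have hpos := hA.sideWeight_pos hs k
    -- Ranks below the inner level add a ball of the inner colour to urn k and go on to the inner
    -- urns.
    have h1 : ∀ r ∈ Finset.Icc 1 (s.2 (k + 1)),
        w r * ∏ j ∈ Finset.Ico k K, sideFactor A (a j) (sideStep r s) j =
          urnRatio (a k) (sideWeight A s (k + 1) + 1) (sideWeight A s k + 1) *
            (w r * ∏ j ∈ Finset.Ico (k + 1) K, sideFactor A (a j) (sideStep r s) j) := by
      intro r hr
      have hr' := (Finset.mem_Icc.1 hr).2
      rw [Finset.prod_eq_prod_Ico_succ_bot hK, sideFactor, if_pos,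
        sideWeight_sideStep_of_le hk hr', sideWeight_sideStep_of_le hk.le (hr'.trans hlt.le)]
      · ring
      · simp only [sideStep]
        split_ifs <;> omega
    -- Ranks in the gap add a ball of the outer colour to urn k and leave all inner urns frozen.
    have h2 : ∀ r ∈ Finset.Ioc (s.2 (k + 1)) (s.2 k),
        w r * ∏ j ∈ Finset.Ico k K, sideFactor A (a j) (sideStep r s) j =
          w r * (urnRatio (a k) (sideWeight A s (k + 1)) (sideWeight A s k + 1) *
            ∏ j ∈ Finset.Ico (k + 1) K, sideFactor A (a j) s j) := by
      intro r hr
      have hr' := Finset.mem_Ioc.1 hr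
      rw [Finset.prod_eq_prod_Ico_succ_bot hK, sideFactor, if_pos,
        sideWeight_sideStep_of_lt hk hr'.1, sideWeight_sideStep_of_le hk.le hr'.2]
      · congr 2
        refine Finset.prod_congr rfl fun j hj => hs.sideFactor_sideStep_of_lt _ ?_
        exact (hs.antitone (Finset.mem_Ico.1 hj).1).trans_lt hr'.1
      · simp only [sideStep]
        split_ifs <;> omega
    have h3 : ∑ r ∈ Finset.Ioc (s.2 (k + 1)) (s.2 k), w r =
        q * (sideWeight A s k - sideWeight A s (k + 1)) := by
      have := sum_Icc_one_add_sum_Ioc w hlt.le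
      rw [hw k hk.le, hw (k + 1) hk] at this
      linarith
    rw [sum_Icc_one_add_sum_Ioc _ hlt.le, Finset.sum_congr rfl h1, Finset.sum_congr rfl h2,
      ← Finset.mul_sum, ← Finset.sum_mul, ih, h3, Finset.prod_eq_prod_Ico_succ_bot hK]
    conv_rhs => rw [sideFactor, if_pos hk]
    linear_combination (q * ∏ j ∈ Finset.Ico (k + 1) K, sideFactor A (a j) s j) *
      urnRatio_harmonic (a k) (x := sideWeight A s (k + 1)) hpos

/-! ### Both sides -/

/-- The product of the harmonic functions of all urns up to the `K`-th one on both sides, at time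
`n`, if the sides have the states `s` and `t`. -/
noncomputable def urnProduct (A B : ℕ → ℝ) (a₀ : ℕ) (a b : ℕ → ℕ) (K n : ℕ)
    (s t : ℕ × (ℕ → ℕ)) : ℝ :=
  urnRatio a₀ (sideWeight A s 0) (A 0 + B 0 + n - 1) *
    (∏ j ∈ Finset.Ico 0 K, sideFactor A (a j) s j) * ∏ j ∈ Finset.Ico 0 K, sideFactor B (b j) t j

variable {B : ℕ → ℝ} {t : ℕ × (ℕ → ℕ)}

/-- The center has value r_0 from below and n + 1 - r_0 from above, so the weights of the two sides
add up to the normalizing constant of the urn scheme. -/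
theorem sideWeight_add_sideWeight {n : ℕ} (hst : s.2 0 + t.2 0 = n + 1) :
    sideWeight A s 0 + sideWeight B t 0 = A 0 + B 0 + n - 1 := by
  have h : (s.2 0 : ℝ) + t.2 0 = n + 1 := by exact_mod_cast hst
  rw [sideWeight, sideWeight]
  linarith

theorem urnProduct_mem_Icc (hA : SideParams A) (hB : SideParams B) (hs : IsSideState s)
    (ht : IsSideState t) {n : ℕ} (hst : s.2 0 + t.2 0 = n + 1) (a₀ : ℕ) (a b : ℕ → ℕ) (K : ℕ) :
    urnProduct A B a₀ a b K n s t ∈ Set.Icc (0 : ℝ) 1 := by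
  have h0 := urnRatio_mem_Icc a₀ (y := A 0 + B 0 + n - 1) (hA.sideWeight_pos hs 0)
    (by have := sideWeight_add_sideWeight (A := A) (B := B) hst
        have := hB.sideWeight_pos ht 0
        linarith)
  have h1 := fun j => hA.sideFactor_mem_Icc hs (a j) j
  have h2 := fun j => hB.sideFactor_mem_Icc ht (b j) j
  have h3 := Finset.prod_nonneg (s := Finset.Ico 0 K) fun j _ => (h1 j).1
  have h4 := Finset.prod_nonneg (s := Finset.Ico 0 K) fun j _ => (h2 j).1
  have h5 := Finset.prod_le_one (s := Finset.Ico 0 K) (fun j _ => (h1 j).1) fun j _ => (h1 j).2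
  have h6 := Finset.prod_le_one (s := Finset.Ico 0 K) (fun j _ => (h2 j).1) fun j _ => (h2 j).2
  exact ⟨mul_nonneg (mul_nonneg h0.1 h3) h4, mul_le_one₀ (mul_le_one₀ h0.2 h3 h5) h4 h6⟩

/-- The product of the harmonic functions of all urns is harmonic. -/
theorem sum_mul_urnProduct (hA : SideParams A) (hB : SideParams B) (hs : IsSideState s)
    (ht : IsSideState t) {n : ℕ} (hst : s.2 0 + t.2 0 = n + 1) (a₀ : ℕ)
    (a b : ℕ → ℕ) (K : ℕ) {p : ℕ → ℝ} {Q : ℝ}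
    (hp : ∀ k ≤ s.1, ∑ r ∈ Finset.Icc 1 (s.2 k), p r =
      Q / (A 0 + B 0 + n - 1) * sideWeight A s k)
    (hp' : ∀ k ≤ t.1, ∑ r ∈ Finset.Icc 1 (t.2 k), p (n + 2 - r) =
      Q / (A 0 + B 0 + n - 1) * sideWeight B t k) :
    ∑ r ∈ Finset.Icc 1 (n + 1),
      p r * urnProduct A B a₀ a b K (n + 1) (sideStep r s) (sideStep (n + 2 - r) t) =
      Q * urnProduct A B a₀ a b K n s t := by
  have hs0 := hs.one_le 0
  have ht0 := ht.one_le 0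
  have hW := sideWeight_add_sideWeight (A := A) (B := B) hst
  have hN : 0 < A 0 + B 0 + n - 1 := by
    rw [← hW]
    exact add_pos (hA.sideWeight_pos hs 0) (hB.sideWeight_pos ht 0)
  have hN' : A 0 + B 0 + ((n + 1 : ℕ) : ℝ) - 1 = A 0 + B 0 + n - 1 + 1 := by push_cast; ring
  -- The rank `r` counted from below is `n + 2 - r` from above. If `r` is at most the center, the
  -- latter exceeds the level `t.2 0`, so the other side is frozen.
  have h1 : ∀ r ∈ Finset.Icc 1 (s.2 0),
      p r * urnProduct A B a₀ a b K (n + 1) (sideStep r s) (sideStep (n + 2 - r) t) =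
        urnRatio a₀ (sideWeight A s 0 + 1) (A 0 + B 0 + n - 1 + 1) *
          (p r * ∏ j ∈ Finset.Ico 0 K, sideFactor A (a j) (sideStep r s) j) *
          ∏ j ∈ Finset.Ico 0 K, sideFactor B (b j) t j := by
    intro r hr
    have hr' := Finset.mem_Icc.1 hr
    rw [urnProduct, ht.sideStep_eq_self (by omega), hN',
      sideWeight_sideStep_of_le (Nat.zero_le _) hr'.2]
    ring
  have h2 : ∀ r ∈ Finset.Ioc (s.2 0) (n + 1),
      p r * urnProduct A B a₀ a b K (n + 1) (sideStep r s) (sideStep (n + 2 - r) t) =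
        urnRatio a₀ (sideWeight A s 0) (A 0 + B 0 + n - 1 + 1) *
          (∏ j ∈ Finset.Ico 0 K, sideFactor A (a j) s j) *
          (p r * ∏ j ∈ Finset.Ico 0 K, sideFactor B (b j) (sideStep (n + 2 - r) t) j) := by
    intro r hr
    have hr' := Finset.mem_Ioc.1 hr
    rw [urnProduct, hs.sideStep_eq_self hr'.1, hN']
    ring
  have h3 : ∑ r ∈ Finset.Ioc (s.2 0) (n + 1),
      p r * ∏ j ∈ Finset.Ico 0 K, sideFactor B (b j) (sideStep (n + 2 - r) t) j =
      ∑ r ∈ Finset.Icc 1 (t.2 0),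
        p (n + 2 - r) * ∏ j ∈ Finset.Ico 0 K, sideFactor B (b j) (sideStep r t) j := by
    refine Finset.sum_nbij' (fun r => n + 2 - r) (fun r => n + 2 - r) ?_ ?_ ?_ ?_ ?_
    · intro r hr
      simp only [Finset.mem_Ioc, Finset.mem_Icc] at hr ⊢
      omega
    · intro r hr
      simp only [Finset.mem_Ioc, Finset.mem_Icc] at hr ⊢
      omega
    · intro r hr
      simp only [Finset.mem_Ioc] at hr
      omega
    · intro r hr
      simp only [Finset.mem_Icc] at hr
      omega
    · intro r hr
      simp only [Finset.mem_Ioc] at hr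
      rw [show n + 2 - (n + 2 - r) = r by omega]
  rw [sum_Icc_one_add_sum_Ioc _ (by omega : s.2 0 ≤ n + 1), Finset.sum_congr rfl h1,
    Finset.sum_congr rfl h2, ← Finset.mul_sum, ← Finset.sum_mul, ← Finset.mul_sum, h3,
    hA.sum_mul_prod_sideFactor hs a hp K (Nat.zero_le _),
    hB.sum_mul_prod_sideFactor ht b hp' K (Nat.zero_le _), urnProduct]
  have h4 := urnRatio_harmonic a₀ (x := sideWeight A s 0) hN
  rw [show sideWeight B t 0 = A 0 + B 0 + n - 1 - sideWeight A s 0 by linarith]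
  have h5 : Q / (A 0 + B 0 + n - 1) * (A 0 + B 0 + n - 1) = Q := div_mul_cancel₀ _ hN.ne'
  linear_combination (Q / (A 0 + B 0 + n - 1) * (∏ j ∈ Finset.Ico 0 K, sideFactor A (a j) s j) *
    ∏ j ∈ Finset.Ico 0 K, sideFactor B (b j) t j) * h4 +
    urnRatio a₀ (sideWeight A s 0) (A 0 + B 0 + n - 1) *
      (∏ j ∈ Finset.Ico 0 K, sideFactor A (a j) s j) *
      (∏ j ∈ Finset.Ico 0 K, sideFactor B (b j) t j) * h5

/-- As the denominator tends to infinity, the bounded shifts are negligible and each of the `a`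
factors has the limit `c`. -/
theorem tendsto_urnRatio {x y : ℕ → ℝ} {c : ℝ} (hy : Tendsto y atTop atTop)
    (h : Tendsto (fun n => x n / y n) atTop (𝓝 c)) (a : ℕ) :
    Tendsto (fun n => urnRatio a (x n) (y n)) atTop (𝓝 (c ^ a)) := by
  induction a with
  | zero => simp
  | succ a ih =>
    simp only [urnRatio_succ, pow_succ]
    refine ih.mul ?_
    have h1 : Tendsto (fun n => (a : ℝ) / y n) atTop (𝓝 0) := hy.const_div_atTop _
    have h2 := (h.add h1).div (h1.const_add 1) (by simp)
    simp only [add_zero, div_one] at h2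
    refine h2.congr' ?_
    filter_upwards [hy.eventually_gt_atTop 0] with n hn
    have h3 : y n + a ≠ 0 := by positivity
    simp only [Pi.div_apply]
    field_simp

end PolyaRecords

namespace PolyaRecords

/-! ### Parameters -/

@[simp] theorem lowerSum_zero (α : ℤ → ℝ) (θ : ℝ) : lowerSum α θ 0 = θ := by simp [lowerSum]

@[simp] theorem upperSum_zero (α : ℤ → ℝ) (ζ : ℝ) : upperSum α ζ 0 = ζ := by simp [upperSum]

theorem upperSum_succ (α : ℤ → ℝ) (ζ : ℝ) (k : ℕ) :
    upperSum α ζ (k + 1) = upperSum α ζ k + α ((k : ℤ) + 1) := by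
  have h : Finset.Icc (1 : ℤ) ((k + 1 : ℕ) : ℤ) = insert ((k : ℤ) + 1) (Finset.Icc (1 : ℤ) k) := by
    ext x
    simp only [Finset.mem_Icc, Finset.mem_insert]
    omega
  rw [upperSum, upperSum, h, Finset.sum_insert (by simp)]
  ring

theorem lowerSum_eq_upperSum (α : ℤ → ℝ) (θ : ℝ) (k : ℕ) :
    lowerSum α θ k = upperSum (fun j => α (-j)) θ k := by
  rw [lowerSum, upperSum]
  congr 1
  refine Finset.sum_nbij' (fun j => -j) (fun j => -j) ?_ ?_ ?_ ?_ ?_ <;>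
    simp only [Finset.mem_Icc, neg_neg, implies_true] <;> intros <;> omega

theorem upperSum_eq_lowerSum (α : ℤ → ℝ) (ζ : ℝ) (k : ℕ) :
    upperSum α ζ k = lowerSum (fun j => α (-j)) ζ k := by
  rw [lowerSum_eq_upperSum]
  simp

theorem lowerSum_succ (α : ℤ → ℝ) (θ : ℝ) (k : ℕ) :
    lowerSum α θ (k + 1) = lowerSum α θ k + α (-((k : ℤ) + 1)) := by
  rw [lowerSum_eq_upperSum, upperSum_succ, lowerSum_eq_upperSum]

variable {α : ℤ → ℝ} {θ ζ : ℝ}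

theorem PrincipalDomain.lower (h : PrincipalDomain α θ ζ) : SideParams (lowerSum α θ) :=
  ⟨h.lower_pos, fun k => by
    have := h.alpha_lt_one (-((k : ℤ) + 1)) (by omega)
    rw [lowerSum_succ]
    linarith⟩

theorem PrincipalDomain.upper (h : PrincipalDomain α θ ζ) : SideParams (upperSum α ζ) :=
  ⟨h.upper_pos, fun k => by
    have := h.alpha_lt_one ((k : ℤ) + 1) (by omega)
    rw [upperSum_succ]
    linarith⟩

variable {Ω : Type*} {π : ∀ n : ℕ, Ω → Equiv.Perm (Fin n)}

/-! ### The two sides along the process -/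

theorem stepEvent_reversal (π : ∀ n : ℕ, Ω → Equiv.Perm (Fin n)) {n : ℕ}
    (σ : Equiv.Perm (Fin n)) {r : ℕ} (h1 : 1 ≤ r) (h2 : r ≤ n + 1) :
    stepEvent (fun n ω => reversal (π n ω)) σ r = stepEvent π (reversal σ) (n + 2 - r) := by
  ext ω
  have h3 : reversal (π n ω) = σ ↔ π n ω = reversal σ := by
    constructor
    · rintro rfl; simp
    · intro h; simp [h]
  have h4 := entry_le (π (n + 1) ω) (Fin.last n)
  simp only [stepEvent, Set.mem_ofPred_eq, initialRank_last, entry_reversal, h3]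
  refine and_congr_right fun _ => ?_
  omega

theorem setOf_reversal_eq (π : ∀ n : ℕ, Ω → Equiv.Perm (Fin n)) {n : ℕ}
    (σ : Equiv.Perm (Fin n)) : {ω | reversal (π n ω) = σ} = {ω | π n ω = reversal σ} := by
  ext ω
  constructor
  · rintro rfl; simp
  · intro h; simp [show π n ω = _ from h]

/-- The state of the upper side, counted from the top. -/
def upperState {n : ℕ} (σ : Equiv.Perm (Fin n)) : ℕ × (ℕ → ℕ) := lowerState (reversal σ)

theorem lowerState_add_upperState {n : ℕ} (hn : 1 ≤ n) (σ : Equiv.Perm (Fin n)) :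
    (lowerState σ).2 0 + (upperState σ).2 0 = n + 1 := by
  have h1 := recordValue_le hn σ 0
  have h2 := recordValue_reversal hn σ 0
  simp only [upperState, lowerState, Nat.cast_zero, neg_zero] at h2 ⊢
  omega

theorem upperState_succ {ω : Ω} (h : Coherent fun n => π n ω) {n : ℕ} (hn : 1 ≤ n) :
    upperState (π (n + 1) ω) =
      sideStep (n + 2 - entry (π (n + 1) ω) (Fin.last n)) (upperState (π n ω)) := by
  have := (h.reversal.extends n).lowerState hn
  rwa [entry_reversal] at this

/-- The product of the harmonic functions of the first urns, along the process. -/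
noncomputable def urnValue (α : ℤ → ℝ) (θ ζ : ℝ) (a₀ : ℕ) (a b : ℕ → ℕ) (K : ℕ) {n : ℕ}
    (σ : Equiv.Perm (Fin n)) : ℝ :=
  urnProduct (lowerSum α θ) (upperSum α ζ) a₀ a b K n (lowerState σ) (upperState σ)

theorem urnValue_mem_Icc (hdom : PrincipalDomain α θ ζ) {ω : Ω} (h : Coherent fun n => π n ω)
    (a₀ : ℕ) (a b : ℕ → ℕ) (K : ℕ) {n : ℕ} (hn : 1 ≤ n) :
    urnValue α θ ζ a₀ a b K (π n ω) ∈ Set.Icc (0 : ℝ) 1 :=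
  urnProduct_mem_Icc hdom.lower hdom.upper (h.isSideState hn) (h.reversal.isSideState hn)
    (lowerState_add_upperState hn _) a₀ a b K

/-! ### One step of the process -/

instance permMeasurableSpace (n : ℕ) : MeasurableSpace (Equiv.Perm (Fin n)) := ⊤

instance permDiscreteMeasurableSpace (n : ℕ) : DiscreteMeasurableSpace (Equiv.Perm (Fin n)) :=
  ⟨fun _ => trivial⟩

variable [MeasurableSpace Ω] {P : Measure Ω}

theorem IsPolyaRecordSequence.measurable (h : IsPolyaRecordSequence P π α θ ζ) (n : ℕ) :
    Measurable (π n) :=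
  measurable_to_countable' fun σ => h.measurableSet_eq n σ

theorem IsPolyaRecordSequence.measurableSet_stepEvent (h : IsPolyaRecordSequence P π α θ ζ)
    {n : ℕ} (σ : Equiv.Perm (Fin n)) (r : ℕ) : MeasurableSet (stepEvent π σ r) :=
  (h.measurableSet_eq n σ).inter
    (h.measurable (n + 1) (Set.toFinite {τ | initialRank τ (Fin.last n) = r}).measurableSet)

/-- The reversed process follows the urn scheme with the two sides interchanged. -/
theorem IsPolyaRecordSequence.reversal (h : IsPolyaRecordSequence P π α θ ζ) :
    IsPolyaRecordSequence P (fun n ω => reversal (π n ω)) (fun k => α (-k)) ζ θ where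
  measurableSet_eq n σ := by
    rw [setOf_reversal_eq]
    exact h.measurableSet_eq n _
  coherent ω := (h.coherent ω).reversal
  prob_lower_record n hn σ := by
    rw [stepEvent_reversal π σ le_rfl (by omega), setOf_reversal_eq, ← upperSum_eq_lowerSum,
      show n + 2 - 1 = n + 1 by omega, h.prob_upper_record n hn, upperCount_reversal,
      add_comm θ ζ]
  prob_upper_record n hn σ := by
    rw [stepEvent_reversal π σ (by omega) le_rfl, setOf_reversal_eq, ← lowerSum_eq_upperSum,
      show n + 2 - (n + 1) = 1 by omega, h.prob_lower_record n hn, lowerCount_reversal,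
      add_comm θ ζ]
  -- Reflection maps the gap between the records k - 1 and k to the one between -k and 1 - k, so the
  -- gap with index k corresponds to the one with index 1 - k.
  prob_below_center n hn σ k r hk h1 h2 := by
    have h3 := recordValue_le hn σ k
    have h4 := recordValue_le hn σ (k - 1)
    have h5 := recordValue_reversal hn σ (-k)
    have h6 := recordValue_reversal hn σ (1 - k)
    rw [neg_neg] at h5
    rw [show -(1 - k) = k - 1 by ring] at h6
    have := h.prob_above_center n hn (PolyaRecords.reversal σ) (1 - k) (n + 2 - r) (by omega)
      (by rw [show 1 - k - 1 = -k by ring]; omega) (by omega)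
    rw [stepEvent_reversal π σ (by omega) (by omega), setOf_reversal_eq, this,
      show 1 - k - 1 = -k by ring, h5, h6, Nat.cast_sub (by omega), Nat.cast_sub (by omega),
      show -(k - 1) = 1 - k by ring, add_comm θ ζ]
    push_cast
    ring_nf
  prob_above_center n hn σ k r hk h1 h2 := by
    have h3 := recordValue_le hn σ k
    have h4 := recordValue_le hn σ (k - 1)
    have h5 := recordValue_reversal hn σ (-k)
    have h6 := recordValue_reversal hn σ (1 - k)
    rw [neg_neg] at h5
    rw [show -(1 - k) = k - 1 by ring] at h6
    have := h.prob_below_center n hn (PolyaRecords.reversal σ) (1 - k) (n + 2 - r) (by omega)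
      (by rw [show 1 - k - 1 = -k by ring]; omega) (by omega)
    rw [stepEvent_reversal π σ (by omega) (by omega), setOf_reversal_eq, this,
      show 1 - k - 1 = -k by ring, h5, h6, Nat.cast_sub (by omega), Nat.cast_sub (by omega),
      add_comm θ ζ]
    push_cast
    ring_nf

theorem PrincipalDomain.reversal (h : PrincipalDomain α θ ζ) :
    PrincipalDomain (fun k => α (-k)) ζ θ where
  alpha_lt_one k hk := h.alpha_lt_one (-k) (by omega)
  lower_pos l := by rw [← upperSum_eq_lowerSum]; exact h.upper_pos l
  upper_pos l := by rw [← lowerSum_eq_upperSum]; exact h.lower_pos l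

/-- The rank 1 contributes A_ℓ, and a gap of length g contributes g(1 - α/g) = g - α. Adding the
gaps outward from the lowest level, each α turns A_{k+1} back into A_k and the lengths add up to
r_{-k} - 1. -/
theorem IsPolyaRecordSequence.sum_stepEvent (h : IsPolyaRecordSequence P π α θ ζ) {n : ℕ}
    (hn : 1 ≤ n) {σ : Equiv.Perm (Fin n)} (hs : IsSideState (lowerState σ)) {k : ℕ}
    (hk : k ≤ (lowerState σ).1) :
    ∑ r ∈ Finset.Icc 1 ((lowerState σ).2 k), P.real (stepEvent π σ r) =
      P.real {ω | π n ω = σ} / (θ + ζ + n - 1) * sideWeight (lowerSum α θ) (lowerState σ) k := by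
  induction hk using Nat.decreasingInduction with
  | self =>
    rw [sideWeight, hs.eq_one _ le_rfl, Finset.Icc_self, Finset.sum_singleton,
      h.prob_lower_record n hn]
    simp only [lowerState, Nat.cast_one, add_sub_cancel_right]
    ring
  | of_succ k hk ih =>
    have hlt := hs.lt k hk
    have hc : ((lowerState σ).2 k : ℝ) - (lowerState σ).2 (k + 1) ≠ 0 := by
      have : ((lowerState σ).2 (k + 1) : ℝ) < (lowerState σ).2 k := by exact_mod_cast hlt
      linarith
    have hk1 : recordValue σ (-(k : ℤ) - 1) = (lowerState σ).2 (k + 1) := by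
      simp only [lowerState]
      congr 1
      push_cast
      ring
    have h1 : ∀ r ∈ Finset.Ioc ((lowerState σ).2 (k + 1)) ((lowerState σ).2 k),
        P.real (stepEvent π σ r) = P.real {ω | π n ω = σ} *
        ((1 - α (-(k : ℤ) - 1) / (((lowerState σ).2 k : ℝ) - (lowerState σ).2 (k + 1))) /
          (θ + ζ + n - 1)) := by
      intro r hr
      have hr' := Finset.mem_Ioc.1 hr
      have := h.prob_below_center n hn σ (-(k : ℤ)) r (by omega) (by rw [hk1]; exact hr'.1) hr'.2
      rw [this, hk1]
      rfl
    rw [sum_Icc_one_add_sum_Ioc _ hlt.le, ih, Finset.sum_congr rfl h1, Finset.sum_const,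
      Nat.card_Ioc, nsmul_eq_mul, Nat.cast_sub hlt.le, sideWeight, sideWeight, lowerSum_succ,
      show -((k : ℤ) + 1) = -(k : ℤ) - 1 by ring]
    field_simp
    ring

/-! ### The martingales -/

variable [IsProbabilityMeasure P]

theorem IsPolyaRecordSequence.setIntegral_succ (h : IsPolyaRecordSequence P π α θ ζ) {n : ℕ}
    (σ : Equiv.Perm (Fin n)) (g : Equiv.Perm (Fin (n + 1)) → ℝ) (G : ℕ → ℝ)
    (hg : ∀ ω, π n ω = σ → g (π (n + 1) ω) = G (entry (π (n + 1) ω) (Fin.last n))) :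
    ∫ ω in {ω | π n ω = σ}, g (π (n + 1) ω) ∂P =
      ∑ r ∈ Finset.Icc 1 (n + 1), P.real (stepEvent π σ r) * G r := by
  have hunion : {ω | π n ω = σ} = ⋃ r ∈ Finset.Icc 1 (n + 1), stepEvent π σ r := by
    ext ω
    simp only [stepEvent, Set.mem_ofPred_eq, Set.mem_iUnion, Finset.mem_Icc, initialRank_last,
      exists_prop]
    exact ⟨fun hω => ⟨_, ⟨entry_pos _ _, entry_le _ _⟩, hω, rfl⟩, fun ⟨_, _, hω, _⟩ => hω⟩
  have hfin : ∀ r, ∀ ω ∈ stepEvent π σ r, g (π (n + 1) ω) = G r := by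
    rintro r ω ⟨h1, h2⟩
    rw [initialRank_last] at h2
    rw [hg ω h1, h2]
  rw [hunion, integral_biUnion_finset]
  · refine Finset.sum_congr rfl fun r _ => ?_
    rw [setIntegral_congr_fun (h.measurableSet_stepEvent σ r) (hfin r), setIntegral_const,
      smul_eq_mul]
  · exact fun r _ => h.measurableSet_stepEvent σ r
  · intro r _ r' _ hrr
    refine Set.disjoint_left.2 fun ω h1 h2 => hrr ?_
    rw [← h1.2, ← h2.2]
  · intro r _
    exact (integrableOn_congr_fun (hfin r) (h.measurableSet_stepEvent σ r)).2
      (integrableOn_const (by simp))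

theorem IsPolyaRecordSequence.setIntegral_urnValue_succ
    (h : IsPolyaRecordSequence P π α θ ζ) (hdom : PrincipalDomain α θ ζ)
    (a₀ : ℕ) (a b : ℕ → ℕ) (K : ℕ) {n : ℕ} (hn : 1 ≤ n) (σ : Equiv.Perm (Fin n)) :
    ∫ ω in {ω | π n ω = σ}, urnValue α θ ζ a₀ a b K (π (n + 1) ω) ∂P =
      ∫ ω in {ω | π n ω = σ}, urnValue α θ ζ a₀ a b K (π n ω) ∂P := by
  have hconst : ∫ ω in {ω | π n ω = σ}, urnValue α θ ζ a₀ a b K (π n ω) ∂P =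
      P.real {ω | π n ω = σ} * urnValue α θ ζ a₀ a b K σ := by
    rw [setIntegral_congr_fun (h.measurableSet_eq n σ)
      (g := fun _ => urnValue α θ ζ a₀ a b K σ), setIntegral_const, smul_eq_mul]
    intro ω hω
    simp only [show π n ω = σ from hω]
  rw [hconst, h.setIntegral_succ σ _ fun r =>
    urnProduct (lowerSum α θ) (upperSum α ζ) a₀ a b K (n + 1) (sideStep r (lowerState σ))
      (sideStep (n + 2 - r) (upperState σ))]
  -- Only a permutation attained by some coherent path is known to have a valid side state; for the
  -- others both sides vanish.
  · rcases Set.eq_empty_or_nonempty {ω | π n ω = σ} with he | ⟨ω, rfl⟩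
    · have : ∀ r, stepEvent π σ r = ∅ := fun r =>
        Set.subset_empty_iff.1 fun ω hω => he ▸ hω.1
      simp [this, he]
    have hs := (h.coherent ω).isSideState hn
    have ht := (h.coherent ω).reversal.isSideState hn
    refine sum_mul_urnProduct hdom.lower hdom.upper hs ht (lowerState_add_upperState hn _) a₀ a b K
      (fun k hk => ?_) fun k hk => ?_
    · simpa using h.sum_stepEvent hn hs hk
    · have h1 := h.reversal.sum_stepEvent hn ht hk
      have h2 : ∀ r ∈ Finset.Icc 1 ((lowerState (PolyaRecords.reversal (π n ω))).2 k),
          P.real (stepEvent π (π n ω) (n + 2 - r)) =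
          P.real (stepEvent (fun n ω => PolyaRecords.reversal (π n ω))
            (PolyaRecords.reversal (π n ω)) r) := by
        intro r hr
        have h3 := Finset.mem_Icc.1 hr
        have h4 : (lowerState (PolyaRecords.reversal (π n ω))).2 k ≤ n := recordValue_le hn _ _
        rw [stepEvent_reversal π _ h3.1 (by omega), reversal_reversal]
      rw [setOf_reversal_eq, reversal_reversal] at h1
      rw [Finset.sum_congr rfl h2]
      simp only [lowerSum_zero, upperSum_zero, add_comm θ ζ]
      refine h1.trans ?_
      simp only [sideWeight, upperSum_eq_lowerSum]
  · intro ω hω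
    rw [← hω, urnValue, ((h.coherent ω).extends n).lowerState hn,
      upperState_succ (h.coherent ω) hn]

/-- The filtration generated by the process, from time one on. -/
def IsPolyaRecordSequence.filtration (h : IsPolyaRecordSequence P π α θ ζ) :
    Filtration ℕ ‹MeasurableSpace Ω› where
  seq n := MeasurableSpace.comap (π (n + 1)) ⊤
  mono' := by
    rintro m n hmn _ ⟨S, -, rfl⟩
    -- An event of the past is the preimage of its own image, because the later permutation
    -- determines the earlier one.
    refine ⟨π (n + 1) '' (π (m + 1) ⁻¹' S), trivial, ?_⟩
    ext ω
    constructor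
    · rintro ⟨ω', hω', he⟩
      have := Coherent.eq_of_le (h.coherent ω') (h.coherent ω) (Nat.succ_le_succ hmn) he
      simp only [Set.mem_preimage] at hω' ⊢
      rwa [← this]
    · exact fun hω => ⟨ω, hω, rfl⟩
  le' n := (h.measurable (n + 1)).comap_le

theorem IsPolyaRecordSequence.integrable_urnValue (h : IsPolyaRecordSequence P π α θ ζ)
    (hdom : PrincipalDomain α θ ζ) (a₀ : ℕ) (a b : ℕ → ℕ) (K : ℕ) {n : ℕ} (hn : 1 ≤ n) :
    Integrable (fun ω => urnValue α θ ζ a₀ a b K (π n ω)) P := by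
  refine Integrable.of_bound (C := 1)
    ((measurable_from_top (f := urnValue α θ ζ a₀ a b K)).comp
      (h.measurable n)).aestronglyMeasurable (ae_of_all _ fun ω => ?_)
  have := urnValue_mem_Icc hdom (h.coherent ω) a₀ a b K hn
  rw [Real.norm_of_nonneg this.1]
  exact this.2

theorem IsPolyaRecordSequence.martingale_urnValue (h : IsPolyaRecordSequence P π α θ ζ)
    (hdom : PrincipalDomain α θ ζ) (a₀ : ℕ) (a b : ℕ → ℕ) (K : ℕ) :
    Martingale (fun n ω => urnValue α θ ζ a₀ a b K (π (n + 1) ω)) h.filtration P := by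
  refine martingale_of_setIntegral_eq_succ (fun n => ?_)
    (fun n => h.integrable_urnValue hdom a₀ a b K (by omega)) ?_
  · exact ((measurable_from_top (f := urnValue α θ ζ a₀ a b K)).comp
      (comap_measurable (π (n + 1)))).stronglyMeasurable
  · rintro n _ ⟨S, -, rfl⟩
    have hS : π (n + 1) ⁻¹' S = ⋃ σ ∈ S.toFinite.toFinset, {ω | π (n + 1) ω = σ} := by
      ext ω
      simp
    have hdisj : (S.toFinite.toFinset : Set (Equiv.Perm (Fin (n + 1)))).Pairwise
        (Function.onFun Disjoint fun σ => {ω | π (n + 1) ω = σ}) := by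
      intro σ _ τ _ hστ
      exact Set.disjoint_left.2 fun ω h1 h2 => hστ (h1.symm.trans h2)
    rw [hS, integral_biUnion_finset _ (fun σ _ => h.measurableSet_eq _ σ) hdisj,
      integral_biUnion_finset _ (fun σ _ => h.measurableSet_eq _ σ) hdisj]
    · exact Finset.sum_congr rfl fun σ _ =>
        (h.setIntegral_urnValue_succ hdom a₀ a b K (by omega) σ).symm
    · exact fun σ _ => (h.integrable_urnValue hdom a₀ a b K (by omega)).integrableOn
    · exact fun σ _ => (h.integrable_urnValue hdom a₀ a b K (by omega)).integrableOn

/-- The mean of a martingale is constant, and at time one the state is deterministic: no urn but the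
central one is active, so all others show their placeholder values. -/
theorem IsPolyaRecordSequence.integral_urnValue (h : IsPolyaRecordSequence P π α θ ζ)
    (hdom : PrincipalDomain α θ ζ) (a₀ : ℕ) (a b : ℕ → ℕ) (K n : ℕ) :
    ∫ ω, urnValue α θ ζ a₀ a b K (π (n + 1) ω) ∂P =
      urnRatio a₀ θ (θ + ζ) *
        (∏ j ∈ Finset.Ico 0 K, urnRatio (a j) (lowerSum α θ (j + 1)) (lowerSum α θ j + 1)) *
        ∏ j ∈ Finset.Ico 0 K, urnRatio (b j) (upperSum α ζ (j + 1)) (upperSum α ζ j + 1) := by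
  have h1 := (h.martingale_urnValue hdom a₀ a b K).setIntegral_eq (Nat.zero_le n)
    (MeasurableSet.univ)
  simp only [setIntegral_univ] at h1
  rw [← h1]
  have h2 : ∀ σ : Equiv.Perm (Fin (0 + 1)), urnValue α θ ζ a₀ a b K σ = urnRatio a₀ θ (θ + ζ) *
        (∏ j ∈ Finset.Ico 0 K, urnRatio (a j) (lowerSum α θ (j + 1)) (lowerSum α θ j + 1)) *
        ∏ j ∈ Finset.Ico 0 K, urnRatio (b j) (upperSum α ζ (j + 1)) (upperSum α ζ j + 1) := by
    intro σ
    rw [urnValue, urnProduct, upperState, lowerState_one, lowerState_one]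
    simp [sideFactor, sideWeight]
  simp [h2]

end PolyaRecords

namespace PolyaRecords

/-! ### Infinitely many records -/

theorem not_summable_one_div_add (c : ℝ) : ¬ Summable fun n : ℕ => 1 / ((n : ℝ) + c) := by
  intro h
  -- Shifting by `M` dominates the constant `c`; shifting by `M'` below makes the denominators
  -- positive.
  obtain ⟨M, hM⟩ := exists_nat_ge (max c 1)
  have hM1 : (1 : ℝ) ≤ M := (le_max_right _ _).trans hM
  have hMc : c ≤ M := (le_max_left _ _).trans hM
  obtain ⟨M', hM'⟩ := exists_nat_gt (-c)
  refine Real.not_summable_one_div_natCast ((summable_nat_add_iff (M + M')).1 ?_)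
  refine Summable.of_nonneg_of_le (fun n => by positivity) (fun n => ?_)
    ((summable_nat_add_iff M').2 h)
  push_cast
  refine one_div_le_one_div_of_le ?_ (by linarith)
  have : (0 : ℝ) ≤ n := Nat.cast_nonneg n
  linarith

/-- A nonnegative sequence that loses a harmonic proportion of itself, up to a null sequence,
in each step tends to zero. -/
theorem tendsto_zero_of_harmonic_loss {e d : ℕ → ℝ} {c N : ℝ} (hc : 0 < c) (hN : 0 < N)
    (he : ∀ n, 0 ≤ e n) (hanti : Antitone e) (hd : Tendsto d atTop (𝓝 0))
    (h : ∀ n : ℕ, e (n + 1) + c / (n + N) * (e n - d n) ≤ e n) : Tendsto e atTop (𝓝 0) := by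
  -- If the limit l were positive, then eventually d < l/2 and each step would lose at least
  -- c(l/2)/(n + N); these losses have an infinite sum.
  have hlim : Tendsto e atTop (𝓝 (⨅ n, e n)) :=
    tendsto_atTop_ciInf hanti ⟨0, by rintro _ ⟨n, rfl⟩; exact he n⟩
  set l := ⨅ n, e n
  have hl : ∀ n, l ≤ e n := fun n => ciInf_le ⟨0, by rintro _ ⟨n, rfl⟩; exact he n⟩ n
  have hl0 : 0 ≤ l := le_ciInf he
  rcases hl0.eq_or_lt with hl0 | hl0
  · rwa [← hl0] at hlim
  exfalso
  obtain ⟨n₀, hn₀⟩ := (hd.eventually_lt_const (half_pos hl0)).exists_forall_of_atTop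
  have hsum : ∀ m : ℕ, ∑ i ∈ Finset.range m, (c * (l / 2)) * (1 / ((i : ℝ) + (n₀ + N))) ≤
      e n₀ - e (n₀ + m) := by
    intro m
    induction m with
    | zero => simp
    | succ m ih =>
      rw [Finset.sum_range_succ]
      have h1 := h (n₀ + m)
      have h2 := hn₀ (n₀ + m) (by omega)
      have h3 := hl (n₀ + m)
      have h4 : c / (((n₀ + m : ℕ) : ℝ) + N) * (l / 2) ≤
          c / (((n₀ + m : ℕ) : ℝ) + N) * (e (n₀ + m) - d (n₀ + m)) :=
        mul_le_mul_of_nonneg_left (by linarith) (by positivity)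
      have h5 : (c * (l / 2)) * (1 / ((m : ℝ) + (n₀ + N))) =
          c / (((n₀ + m : ℕ) : ℝ) + N) * (l / 2) := by
        push_cast
        rw [show (m : ℝ) + (n₀ + N) = n₀ + m + N by ring]
        ring
      rw [h5, ← add_assoc n₀ m 1]
      linarith
  have hs : Summable fun i : ℕ => (c * (l / 2)) * (1 / ((i : ℝ) + (n₀ + N))) :=
    summable_of_sum_range_le (c := e n₀) (fun i => by positivity) fun m =>
      (hsum m).trans (by linarith [he (n₀ + m)])
  rw [summable_mul_left_iff (by positivity)] at hs
  exact not_summable_one_div_add _ hs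

theorem lowerCount_mono {π : ∀ n : ℕ, Equiv.Perm (Fin n)} (h : Coherent π) :
    Monotone fun n => (lowerState (π (n + 1))).1 := by
  refine monotone_nat_of_le_succ fun n => ?_
  rw [(h.extends (n + 1)).lowerState (by omega)]
  simp only [sideStep]
  split_ifs <;> omega

theorem eventually_isSideState {π : ∀ n : ℕ, Equiv.Perm (Fin n)} (h : Coherent π) :
    ∀ᶠ n in atTop, IsSideState (lowerState (π n)) :=
  (eventually_ge_atTop 1).mono fun _ hn => h.isSideState hn

variable {α : ℤ → ℝ} {θ ζ : ℝ} {Ω : Type*} {π : ∀ n : ℕ, Ω → Equiv.Perm (Fin n)}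
  [MeasurableSpace Ω] {P : Measure Ω}

theorem IsPolyaRecordSequence.measurableSet_setOf (h : IsPolyaRecordSequence P π α θ ζ) {n : ℕ}
    (p : Equiv.Perm (Fin n) → Prop) : MeasurableSet {ω | p (π n ω)} :=
  h.measurable n (Set.toFinite {σ | p σ}).measurableSet

/-- The product of the harmonic functions, with exponents indexed by `ℤ`. -/
noncomputable def urnMonomial (α : ℤ → ℝ) (θ ζ : ℝ) (e : ℤ → ℕ) (K : ℕ) {n : ℕ}
    (σ : Equiv.Perm (Fin n)) : ℝ :=
  urnValue α θ ζ (e 0) (fun j => e (-((j : ℤ) + 1))) (fun j => e ((j : ℤ) + 1)) K σ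

/-- The limit of the proportions in the `k`-th urn, projected to the unit interval. -/
noncomputable def IsPolyaRecordSequence.limit (h : IsPolyaRecordSequence P π α θ ζ) (k : ℤ)
    (ω : Ω) : unitInterval :=
  Set.projIcc 0 1 zero_le_one (Filtration.limitProcess
    (fun n ω => urnMonomial α θ ζ (Pi.single k 1) k.natAbs (π (n + 1) ω)) h.filtration P ω)

theorem IsPolyaRecordSequence.measurable_limit (h : IsPolyaRecordSequence P π α θ ζ) (k : ℤ) :
    Measurable (h.limit k) :=
  continuous_projIcc.measurable.comp Filtration.stronglyMeasurable_limit_process'.measurable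

variable [IsProbabilityMeasure P]

/-- Staying at no more than k records and passing from k to k + 1 by a new record are disjoint
events, both inside the event of having at most k records at time n. -/
theorem IsPolyaRecordSequence.measureReal_lowerCount_step (h : IsPolyaRecordSequence P π α θ ζ)
    {n : ℕ} (hn : 1 ≤ n) (k : ℕ) :
    P.real {ω | (lowerState (π (n + 1) ω)).1 ≤ k} +
      lowerSum α θ k / (θ + ζ + n - 1) * P.real {ω | (lowerState (π n ω)).1 = k} ≤
      P.real {ω | (lowerState (π n ω)).1 ≤ k} := by
  classical
  set S : Finset (Equiv.Perm (Fin n)) := Finset.univ.filter fun σ => (lowerState σ).1 = k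
  have hdisj : ∀ T : Equiv.Perm (Fin n) → Set Ω, (∀ σ, T σ ⊆ {ω | π n ω = σ}) →
      (S : Set (Equiv.Perm (Fin n))).PairwiseDisjoint T := fun T hT σ _ τ _ hστ =>
    Set.disjoint_left.2 fun ω h1 h2 =>
      hστ ((show π n ω = σ from hT σ h1).symm.trans (hT τ h2))
  have h1 : P.real {ω | (lowerState (π n ω)).1 = k} = ∑ σ ∈ S, P.real {ω | π n ω = σ} := by
    rw [← measureReal_biUnion_finset (hdisj _ fun _ => subset_rfl)
      fun σ _ => h.measurableSet_eq n σ]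
    congr 1
    ext ω
    simp [S]
  have h2 : P.real (⋃ σ ∈ S, stepEvent π σ 1) =
      lowerSum α θ k / (θ + ζ + n - 1) * P.real {ω | (lowerState (π n ω)).1 = k} := by
    rw [measureReal_biUnion_finset (hdisj _ fun σ ω hω => hω.1)
      fun σ _ => h.measurableSet_stepEvent σ 1, h1, Finset.mul_sum]
    refine Finset.sum_congr rfl fun σ hσ => ?_
    have : lowerCount σ = k := (Finset.mem_filter.1 hσ).2
    rw [h.prob_lower_record n hn, this, mul_comm]
  rw [← h2, ← measureReal_union ?_ ?_ (measure_ne_top _ _) (measure_ne_top _ _)]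
  · refine measureReal_mono ?_ (measure_ne_top _ _)
    rintro ω (hω | hω)
    · refine le_trans ?_ (show (lowerState (π (n + 1) ω)).1 ≤ k from hω)
      obtain ⟨m, rfl⟩ := Nat.exists_eq_add_of_le' hn
      exact lowerCount_mono (h.coherent ω) (Nat.le_succ m)
    · simp only [Set.mem_iUnion] at hω
      obtain ⟨σ, hσ, rfl, -⟩ := hω
      exact (Finset.mem_filter.1 hσ).2.le
  · refine Set.disjoint_left.2 fun ω h3 h4 => ?_
    simp only [Set.mem_iUnion] at h4
    obtain ⟨σ, hσ, rfl, h5⟩ := h4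
    have h6 := (Finset.mem_filter.1 hσ).2
    rw [initialRank_last] at h5
    simp only [Set.mem_ofPred_eq, ((h.coherent ω).extends n).lowerState hn, h5, sideStep] at h3
    simp at h3
    omega
  · exact Finset.measurableSet_biUnion _ fun σ _ => h.measurableSet_stepEvent σ 1

/-- Induction on k: the probability of exactly k records is e - d, where e is that of at most k and
d that of fewer than k. The induction hypothesis says d → 0, and the harmonic loss then forces e →
0. -/
theorem IsPolyaRecordSequence.tendsto_measureReal_lowerCount_lt
    (h : IsPolyaRecordSequence P π α θ ζ) (hdom : PrincipalDomain α θ ζ) (k : ℕ) :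
    Tendsto (fun n => P.real {ω | (lowerState (π (n + 1) ω)).1 < k}) atTop (𝓝 0) := by
  have hN : 0 < θ + ζ := by
    have h1 := hdom.lower_pos 0
    have h2 := hdom.upper_pos 0
    simp only [lowerSum_zero, upperSum_zero] at h1 h2
    linarith
  induction k with
  | zero => simp
  | succ k ih =>
    simp only [Nat.lt_succ_iff]
    refine tendsto_zero_of_harmonic_loss (hdom.lower_pos k) hN (fun n => measureReal_nonneg)
      (fun m n hmn => measureReal_mono fun ω hω =>
        (lowerCount_mono (h.coherent ω) hmn).trans hω) ih fun n => ?_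
    have h1 := h.measureReal_lowerCount_step (n := n + 1) (by omega) k
    have h2 : P.real {ω | (lowerState (π (n + 1) ω)).1 ≤ k} =
        P.real {ω | (lowerState (π (n + 1) ω)).1 < k} +
          P.real {ω | (lowerState (π (n + 1) ω)).1 = k} := by
      rw [← measureReal_union]
      · congr 1
        ext ω
        simp [le_iff_lt_or_eq]
      · exact Set.disjoint_left.2 fun ω h1 h2 => (ne_of_lt h1) h2
      · exact h.measurableSet_setOf fun σ => (lowerState σ).1 = k
    rw [show (n : ℝ) + (θ + ζ) = θ + ζ + (n + 1 : ℕ) - 1 by push_cast; ring, h2, add_sub_cancel_left,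
      ← h2]
    exact h1

/-- Almost surely, there are infinitely many lower records. -/
theorem IsPolyaRecordSequence.tendsto_lowerCount
    (h : IsPolyaRecordSequence P π α θ ζ) (hdom : PrincipalDomain α θ ζ) :
    ∀ᵐ ω ∂P, Tendsto (fun n => (lowerState (π n ω)).1) atTop atTop := by
  have h1 : ∀ᵐ ω ∂P, ∀ k : ℕ, ∃ n : ℕ, k ≤ (lowerState (π (n + 1) ω)).1 := by
    refine ae_all_iff.2 fun k => ?_
    rw [ae_iff]
    have h2 : P.real {ω | ¬ ∃ n : ℕ, k ≤ (lowerState (π (n + 1) ω)).1} ≤ 0 := by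
      refine ge_of_tendsto' (h.tendsto_measureReal_lowerCount_lt hdom k) fun n => ?_
      refine measureReal_mono fun ω hω => ?_
      simp only [Set.mem_ofPred_eq, not_exists, not_le] at hω
      exact hω n
    exact (measureReal_eq_zero_iff).1 (h2.antisymm measureReal_nonneg)
  filter_upwards [h1] with ω hω
  exact (tendsto_add_atTop_iff_nat 1).1
    (tendsto_atTop_atTop_of_monotone (lowerCount_mono (h.coherent ω)) hω)

/-! ### Scaling limits on one side -/

theorem tendsto_sideWeight_atTop {A : ℕ → ℝ} {s : ℕ → ℕ × (ℕ → ℕ)}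
    (hs : ∀ᶠ n in atTop, IsSideState (s n)) (hl : Tendsto (fun n => (s n).1) atTop atTop) (k : ℕ) :
    Tendsto (fun n => sideWeight A (s n) k) atTop atTop := by
  have h1 : Tendsto (fun n => (s n).2 k) atTop atTop := by
    refine tendsto_atTop_mono' _ ?_ (tendsto_sub_atTop_nat k |>.comp hl)
    filter_upwards [hs] with n hn
    exact (hn.sub_lt k).le
  simp only [sideWeight, add_sub_right_comm]
  exact tendsto_atTop_add_const_left _ _ (tendsto_natCast_atTop_atTop.comp h1)

theorem eventually_sideFactor_eq {s : ℕ → ℕ × (ℕ → ℕ)}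
    (hl : Tendsto (fun n => (s n).1) atTop atTop) (A : ℕ → ℝ) (a k : ℕ) :
    ∀ᶠ n in atTop, sideFactor A a (s n) k =
      urnRatio a (sideWeight A (s n) (k + 1)) (sideWeight A (s n) k) := by
  filter_upwards [hl.eventually_gt_atTop k] with n hn
  rw [sideFactor, if_pos hn]

theorem tendsto_sideFactor {A : ℕ → ℝ} {s : ℕ → ℕ × (ℕ → ℕ)}
    (hs : ∀ᶠ n in atTop, IsSideState (s n)) (hl : Tendsto (fun n => (s n).1) atTop atTop) {k : ℕ}
    {x : ℝ} (hx : Tendsto (fun n => sideFactor A 1 (s n) k) atTop (𝓝 x)) (a : ℕ) :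
    Tendsto (fun n => sideFactor A a (s n) k) atTop (𝓝 (x ^ a)) := by
  refine (tendsto_urnRatio (tendsto_sideWeight_atTop (A := A) hs hl k) ?_ a).congr'
    ((eventually_sideFactor_eq hl A a k).mono fun n hn => hn.symm)
  refine hx.congr' ?_
  filter_upwards [eventually_sideFactor_eq hl A 1 k] with n hn
  rw [hn, urnRatio_one]

/-- The weight W_k telescopes into W_0 times the proportions of the urns 0, …, k - 1, and differs
from the level itself by the constant A_k - 1. -/
theorem tendsto_level_div {A : ℕ → ℝ} {s : ℕ → ℕ × (ℕ → ℕ)}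
    (hs : ∀ᶠ n in atTop, IsSideState (s n)) (hl : Tendsto (fun n => (s n).1) atTop atTop)
    {x₀ : ℝ} {x : ℕ → ℝ} (hx : ∀ k, Tendsto (fun n => sideFactor A 1 (s n) k) atTop (𝓝 (x k)))
    (hx₀ : Tendsto (fun n => sideWeight A (s n) 0 / n) atTop (𝓝 x₀)) (k : ℕ) :
    Tendsto (fun n => ((s n).2 k : ℝ) / n) atTop (𝓝 (x₀ * ∏ j ∈ Finset.range k, x j)) := by
  have h1 : Tendsto (fun n => sideWeight A (s n) k / n) atTop
      (𝓝 (x₀ * ∏ j ∈ Finset.range k, x j)) := by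
    induction k with
    | zero => simpa using hx₀
    | succ k ih =>
      rw [Finset.prod_range_succ, ← mul_assoc]
      refine (ih.mul (hx k)).congr' ?_
      filter_upwards [eventually_sideFactor_eq hl A 1 k,
        (tendsto_sideWeight_atTop (A := A) hs hl k).eventually_gt_atTop 0] with n hn hpos
      rw [hn, urnRatio_one]
      field_simp
  have h2 : Tendsto (fun n : ℕ => (A k - 1) / (n : ℝ)) atTop (𝓝 0) :=
    tendsto_const_div_atTop_nhds_zero_nat _
  have h3 := h1.sub h2
  rw [sub_zero] at h3
  refine h3.congr fun n => ?_
  rw [sideWeight]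
  ring

/-! ### The limit variables -/

/-- Bounded martingale convergence. The exponent 1 at k and 0 elsewhere isolates the k-th urn, and
`k.natAbs` is just large enough for the product to include it. -/
theorem IsPolyaRecordSequence.tendsto_limit (h : IsPolyaRecordSequence P π α θ ζ)
    (hdom : PrincipalDomain α θ ζ) : ∀ᵐ ω ∂P, ∀ k : ℤ,
    Tendsto (fun n => urnMonomial α θ ζ (Pi.single k 1) k.natAbs (π n ω)) atTop
      (𝓝 (h.limit k ω : ℝ)) := by
  refine ae_all_iff.2 fun k => ?_
  have hmem : ∀ n ω, urnMonomial α θ ζ (Pi.single k 1) k.natAbs (π (n + 1) ω) ∈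
      Set.Icc (0 : ℝ) 1 := fun n ω =>
    urnValue_mem_Icc hdom (h.coherent ω) _ _ _ _ (by omega)
  have hmart : Martingale (fun n ω => urnMonomial α θ ζ (Pi.single k 1) k.natAbs (π (n + 1) ω))
    h.filtration P := h.martingale_urnValue hdom _ _ _ _
  have hconv := hmart.submartingale.ae_tendsto_limitProcess (R := 1) fun n => by
    refine (eLpNorm_le_of_ae_bound (C := 1) (ae_of_all _ fun ω => ?_)).trans ?_
    · rw [Real.norm_of_nonneg (hmem n ω).1]
      exact (hmem n ω).2
    · simp
  filter_upwards [hconv] with ω hω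
  rw [← tendsto_add_atTop_iff_nat 1]
  have hlim : Filtration.limitProcess
      (fun n ω => urnMonomial α θ ζ (Pi.single k 1) k.natAbs (π (n + 1) ω)) h.filtration P ω ∈
      Set.Icc (0 : ℝ) 1 := isClosed_Icc.mem_of_tendsto hω (Eventually.of_forall fun n => hmem n ω)
  rwa [limit, Set.projIcc_of_mem _ hlim]

/-- The almost sure convergence of all urns. -/
theorem IsPolyaRecordSequence.tendsto_factors (h : IsPolyaRecordSequence P π α θ ζ)
    (hdom : PrincipalDomain α θ ζ) : ∀ᵐ ω ∂P,
    Tendsto (fun n : ℕ => sideWeight (lowerSum α θ) (lowerState (π n ω)) 0 / (θ + ζ + n - 1)) atTop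
      (𝓝 (h.limit 0 ω)) ∧
    (∀ k : ℕ, Tendsto (fun n => sideFactor (lowerSum α θ) 1 (lowerState (π n ω)) k) atTop
      (𝓝 (h.limit (-((k : ℤ) + 1)) ω))) ∧
    (∀ k : ℕ, Tendsto (fun n => sideFactor (upperSum α ζ) 1 (upperState (π n ω)) k) atTop
      (𝓝 (h.limit ((k : ℤ) + 1) ω))) := by
  have hzero : ∀ (A : ℕ → ℝ) s j, sideFactor A 0 s j = 1 := fun A s j => by simp [sideFactor]
  filter_upwards [h.tendsto_limit hdom] with ω hω
  refine ⟨?_, fun k => ?_, fun k => ?_⟩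
  · refine (hω 0).congr fun n => ?_
    simp [urnMonomial, urnValue, urnProduct]
  · refine (hω (-((k : ℤ) + 1))).congr fun n => ?_
    have h1 : (-((k : ℤ) + 1)).natAbs = k + 1 := by omega
    have h2 : ∀ j : ℕ, j ≠ k → (-((j : ℤ) + 1)) ≠ -((k : ℤ) + 1) := fun j hj => by omega
    have h3 : ∀ j : ℕ, (j : ℤ) + 1 ≠ -((k : ℤ) + 1) := fun j => by omega
    have h4 : (0 : ℤ) ≠ -((k : ℤ) + 1) := by omega
    rw [urnMonomial, urnValue, urnProduct, h1, Pi.single_eq_of_ne h4, urnRatio_zero, one_mul,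
      Finset.prod_eq_single k, Finset.prod_eq_one, Pi.single_eq_same, mul_one]
    · intro j _
      rw [Pi.single_eq_of_ne (h3 j), hzero]
    · intro j _ hj
      rw [Pi.single_eq_of_ne (h2 j hj), hzero]
    · simp
  · refine (hω ((k : ℤ) + 1)).congr fun n => ?_
    have h1 : ((k : ℤ) + 1).natAbs = k + 1 := by omega
    have h2 : ∀ j : ℕ, j ≠ k → (j : ℤ) + 1 ≠ (k : ℤ) + 1 := fun j hj => by omega
    have h3 : ∀ j : ℕ, -((j : ℤ) + 1) ≠ (k : ℤ) + 1 := fun j => by omega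
    have h4 : (0 : ℤ) ≠ (k : ℤ) + 1 := by omega
    rw [urnMonomial, urnValue, urnProduct, h1, Pi.single_eq_of_ne h4, urnRatio_zero, one_mul,
      Finset.prod_eq_one, Finset.prod_eq_single k, Pi.single_eq_same, one_mul]
    · intro j _ hj
      rw [Pi.single_eq_of_ne (h2 j hj), hzero]
    · simp
    · intro j _
      rw [Pi.single_eq_of_ne (h3 j), hzero]

theorem prod_Icc_neg (f : ℤ → ℝ) (k : ℕ) :
    ∏ j ∈ Finset.Icc (-(k : ℤ)) (-1), f j = ∏ j ∈ Finset.range k, f (-((j : ℤ) + 1)) := by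
  refine Finset.prod_bij' (fun j _ => (-j - 1).toNat) (fun j _ => -((j : ℤ) + 1)) ?_ ?_ ?_ ?_ ?_
  · intro j hj; simp only [Finset.mem_Icc, Finset.mem_range] at hj ⊢; omega
  · intro j hj; simp only [Finset.mem_Icc, Finset.mem_range] at hj ⊢; omega
  · intro j hj; simp only [Finset.mem_Icc] at hj; omega
  · intro j _; omega
  · intro j hj
    simp only [Finset.mem_Icc] at hj
    congr 1
    omega

theorem prod_Icc_pos (f : ℤ → ℝ) (k : ℕ) :
    ∏ j ∈ Finset.Icc 1 (k : ℤ), f j = ∏ j ∈ Finset.range k, f ((j : ℤ) + 1) := by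
  refine Finset.prod_bij' (fun j _ => (j - 1).toNat) (fun j _ => (j : ℤ) + 1) ?_ ?_ ?_ ?_ ?_
  · intro j hj; simp only [Finset.mem_Icc, Finset.mem_range] at hj ⊢; omega
  · intro j hj; simp only [Finset.mem_Icc, Finset.mem_range] at hj ⊢; omega
  · intro j hj; simp only [Finset.mem_Icc] at hj; omega
  · intro j _; omega
  · intro j hj
    simp only [Finset.mem_Icc] at hj
    congr 1
    omega

theorem prod_Icc_neg_pos (f : ℤ → ℝ) (K : ℕ) :
    ∏ j ∈ Finset.Icc (-(K : ℤ)) K, f j =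
      f 0 * (∏ j ∈ Finset.Ico 0 K, f (-((j : ℤ) + 1))) * ∏ j ∈ Finset.Ico 0 K, f ((j : ℤ) + 1) := by
  have h : Finset.Icc (-(K : ℤ)) K =
      {0} ∪ (Finset.Icc (-(K : ℤ)) (-1) ∪ Finset.Icc 1 (K : ℤ)) := by
    ext x
    simp only [Finset.mem_Icc, Finset.mem_union, Finset.mem_singleton]
    omega
  rw [h, Finset.prod_union, Finset.prod_union, Finset.prod_singleton, prod_Icc_neg, prod_Icc_pos,
    Finset.range_eq_Ico, mul_assoc]
  · refine Finset.disjoint_left.2 fun x h1 h2 => ?_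
    simp only [Finset.mem_Icc] at h1 h2
    omega
  · refine Finset.disjoint_left.2 fun x h1 h2 => ?_
    simp only [Finset.mem_Icc, Finset.mem_union, Finset.mem_singleton] at h1 h2
    omega

/-- The limits of the scaled record values. -/
noncomputable def recordLimit (X : ℤ → ℝ) (k : ℤ) : ℝ :=
  if 0 < k then 1 - (1 - X 0) * ∏ j ∈ Finset.Icc 1 k, X j
  else X 0 * ∏ j ∈ Finset.Icc k (-1), X j

theorem IsPolyaRecordSequence.tendsto_recordValue (h : IsPolyaRecordSequence P π α θ ζ)
    (hdom : PrincipalDomain α θ ζ) : ∀ᵐ ω ∂P, ∀ k : ℤ,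
    Tendsto (fun n : ℕ => (recordValue (π n ω) k : ℝ) / n) atTop
      (𝓝 (recordLimit (fun j => h.limit j ω) k)) := by
  filter_upwards [h.tendsto_factors hdom, h.tendsto_lowerCount hdom,
    h.reversal.tendsto_lowerCount hdom.reversal] with ω ⟨h0, hlow, hup⟩ hl hu k
  have hNn : Tendsto (fun n : ℕ => (θ + ζ + n - 1) / (n : ℝ)) atTop (𝓝 1) := by
    have := (tendsto_const_div_atTop_nhds_zero_nat (θ + ζ - 1)).const_add 1
    rw [add_zero] at this
    refine this.congr' ?_
    filter_upwards [eventually_gt_atTop 0] with n hn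
    have : (n : ℝ) ≠ 0 := by positivity
    field_simp
    ring
  have hNpos : ∀ᶠ n : ℕ in atTop, 0 < θ + ζ + n - 1 := by
    filter_upwards [tendsto_natCast_atTop_atTop.eventually_gt_atTop (1 - (θ + ζ))] with n hn
    linarith
  rcases lt_or_ge 0 k with hk | hk
  · obtain ⟨k, rfl⟩ := Int.eq_ofNat_of_zero_le hk.le
    rw [recordLimit, if_pos hk, prod_Icc_pos]
    -- The upper weight is the complement of the lower one, so the upper product starts from one
    -- minus the limit of the center.
    have h1 : Tendsto (fun n : ℕ => sideWeight (upperSum α ζ) (upperState (π n ω)) 0 / n) atTop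
        (𝓝 (1 - h.limit 0 ω)) := by
      have := (h0.const_sub 1).mul hNn
      rw [mul_one] at this
      refine this.congr' ?_
      filter_upwards [hNpos, eventually_ge_atTop 1] with n hN hn
      have h2 := sideWeight_add_sideWeight (A := lowerSum α θ) (B := upperSum α ζ)
        (lowerState_add_upperState hn (π n ω))
      simp only [lowerSum_zero, upperSum_zero] at h2
      rw [show sideWeight (upperSum α ζ) (upperState (π n ω)) 0 =
        (θ + ζ + n - 1) - sideWeight (lowerSum α θ) (lowerState (π n ω)) 0 by linarith]
      field_simp
    have h2 := tendsto_level_div (s := fun n => upperState (π n ω))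
      (eventually_isSideState (h.coherent ω).reversal) hu hup h1 k
    have h3 : Tendsto (fun n : ℕ => ((n : ℝ) + 1) / n) atTop (𝓝 1) := by
      have := (tendsto_const_div_atTop_nhds_zero_nat (1 : ℝ)).const_add 1
      rw [add_zero] at this
      refine this.congr' ?_
      filter_upwards [eventually_gt_atTop 0] with n hn
      have : (n : ℝ) ≠ 0 := by positivity
      field_simp
    refine (h3.sub h2).congr' ?_
    filter_upwards [eventually_ge_atTop 1] with n hn
    have h4 : recordValue (PolyaRecords.reversal (π n ω)) (-(k : ℤ)) ≤ n := recordValue_le hn _ _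
    rw [recordValue_nat hn, Nat.cast_sub (by omega)]
    simp only [upperState, lowerState]
    push_cast
    ring
  · obtain ⟨k, rfl⟩ := Int.exists_eq_neg_ofNat hk
    rw [recordLimit, if_neg (by omega), prod_Icc_neg]
    have h1 : Tendsto (fun n : ℕ => sideWeight (lowerSum α θ) (lowerState (π n ω)) 0 / n) atTop
        (𝓝 (h.limit 0 ω)) := by
      have := h0.mul hNn
      rw [mul_one] at this
      refine this.congr' ?_
      filter_upwards [hNpos] with n hN
      field_simp
    exact tendsto_level_div (s := fun n => lowerState (π n ω)) (eventually_isSideState (h.coherent ω)) hl hlow h1 k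

/-! ### Mixed moments of the limits -/

/-- The moments of the limit proportion in the `k`-th urn. -/
noncomputable def urnMoment (α : ℤ → ℝ) (θ ζ : ℝ) (k : ℤ) (a : ℕ) : ℝ :=
  if k < 0 then urnRatio a (lowerSum α θ k.natAbs) (lowerSum α θ (k.natAbs - 1) + 1)
  else if 0 < k then urnRatio a (upperSum α ζ k.natAbs) (upperSum α ζ (k.natAbs - 1) + 1)
  else urnRatio a θ (θ + ζ)

@[simp] theorem urnMoment_zero_right (α : ℤ → ℝ) (θ ζ : ℝ) (k : ℤ) :
    urnMoment α θ ζ k 0 = 1 := by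
  simp [urnMoment]

/-- The martingale is bounded by 1 and converges almost surely to the monomial; by dominated
convergence the monomial inherits its constant mean, which factors over the urns. -/
theorem IsPolyaRecordSequence.integral_prod_limit (h : IsPolyaRecordSequence P π α θ ζ)
    (hdom : PrincipalDomain α θ ζ) (e : ℤ → ℕ) (K : ℕ) :
    ∫ ω, ∏ k ∈ Finset.Icc (-(K : ℤ)) K, (h.limit k ω : ℝ) ^ e k ∂P =
      ∏ k ∈ Finset.Icc (-(K : ℤ)) K, urnMoment α θ ζ k (e k) := by
  have hlim : ∀ᵐ ω ∂P, Tendsto (fun n => urnMonomial α θ ζ e K (π (n + 1) ω)) atTop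
      (𝓝 (∏ k ∈ Finset.Icc (-(K : ℤ)) K, (h.limit k ω : ℝ) ^ e k)) := by
    filter_upwards [h.tendsto_factors hdom, h.tendsto_lowerCount hdom,
      h.reversal.tendsto_lowerCount hdom.reversal] with ω ⟨h0, hlow, hup⟩ hl hu
    rw [prod_Icc_neg_pos, tendsto_add_atTop_iff_nat (f := fun n => urnMonomial α θ ζ e K (π n ω)) 1]
    refine Tendsto.mul (Tendsto.mul ?_ ?_) ?_
    · refine tendsto_urnRatio ?_ (by simpa using h0) _
      have : Tendsto (fun n : ℕ => (lowerSum α θ 0 + upperSum α ζ 0 - 1) + (n : ℝ)) atTop atTop :=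
        tendsto_atTop_add_const_left _ _ tendsto_natCast_atTop_atTop
      exact this.congr fun n => by ring
    · exact tendsto_finsetProd _ fun j _ =>
        tendsto_sideFactor (s := fun n => lowerState (π n ω))
          (eventually_isSideState (h.coherent ω)) hl (hlow j) _
    · exact tendsto_finsetProd _ fun j _ =>
        tendsto_sideFactor (s := fun n => upperState (π n ω))
          (eventually_isSideState (h.coherent ω).reversal) hu (hup j) _
  have hint := tendsto_integral_of_dominated_convergence (fun _ => (1 : ℝ))
    (fun n => (h.integrable_urnValue hdom (e 0) (fun j => e (-((j : ℤ) + 1)))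
      (fun j => e ((j : ℤ) + 1)) K (n := n + 1) (by omega)).aestronglyMeasurable)
    (integrable_const _) (fun n => ae_of_all _ fun ω => by
      have := urnValue_mem_Icc hdom (h.coherent ω) (e 0) (fun j => e (-((j : ℤ) + 1)))
        (fun j => e ((j : ℤ) + 1)) K (n := n + 1) (by omega)
      rw [Real.norm_of_nonneg this.1]
      exact this.2) hlim
  refine tendsto_nhds_unique hint ?_
  simp only [h.integral_urnValue hdom]
  refine tendsto_const_nhds.congr' (Eventually.of_forall fun n => ?_)
  rw [prod_Icc_neg_pos fun k => urnMoment α θ ζ k (e k)]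
  have h1 : ∀ j : ℕ, urnMoment α θ ζ (-((j : ℤ) + 1)) (e (-((j : ℤ) + 1))) =
      urnRatio (e (-((j : ℤ) + 1))) (lowerSum α θ (j + 1)) (lowerSum α θ j + 1) := fun j => by
    rw [urnMoment, if_pos (by omega), show (-((j : ℤ) + 1)).natAbs = j + 1 by omega,
      Nat.add_sub_cancel]
  have h2 : ∀ j : ℕ, urnMoment α θ ζ ((j : ℤ) + 1) (e ((j : ℤ) + 1)) =
      urnRatio (e ((j : ℤ) + 1)) (upperSum α ζ (j + 1)) (upperSum α ζ j + 1) := fun j => by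
    rw [urnMoment, if_neg (by omega), if_pos (by omega), show ((j : ℤ) + 1).natAbs = j + 1 by omega,
      Nat.add_sub_cancel]
  simp only [h1, h2]
  simp [urnMoment]

end PolyaRecords

namespace PolyaRecords

/-! ### Moments of the beta distribution -/

theorem beta_add_nat {p q : ℝ} (hp : 0 < p) (hq : 0 < q) (a : ℕ) :
    beta (p + a) q = beta p q * urnRatio a p (p + q) := by
  induction a with
  | zero => simp
  | succ a ih =>
    have h1 : p + a ≠ 0 := by positivity
    have h2 : p + a + q ≠ 0 := by positivity
    have h3 : p + q + a ≠ 0 := by positivity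
    have h4 : Real.Gamma (p + a + q) ≠ 0 := (Real.Gamma_pos_of_pos (by positivity)).ne'
    rw [urnRatio_succ, ← mul_assoc, ← ih, beta, beta]
    push_cast
    rw [show p + ((a : ℝ) + 1) + q = p + a + q + 1 by ring, ← add_assoc, Real.Gamma_add_one h1,
      Real.Gamma_add_one h2]
    field_simp
    ring

theorem integral_betaPDFReal {p q : ℝ} (hp : 0 < p) (hq : 0 < q) :
    ∫ x, betaPDFReal p q x = 1 := by
  rw [integral_eq_lintegral_of_nonneg_ae (ae_of_all _ fun x => ?_)
    (measurable_betaPDFReal p q).aestronglyMeasurable]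
  · have := lintegral_betaPDF_eq_one hp hq
    simp only [betaPDF] at this
    rw [this, ENNReal.toReal_one]
  · by_cases hx : 0 < x ∧ x < 1
    · exact (betaPDFReal_pos hx.1 hx.2 hp hq).le
    · rw [betaPDFReal, if_neg hx]
      rfl

/-- Multiplying a beta density by a power only raises its first parameter; the ratio of the
normalizing constants is the moment. -/
theorem pow_mul_betaPDFReal {p q : ℝ} (hp : 0 < p) (hq : 0 < q) (a : ℕ) (x : ℝ) :
    betaPDFReal p q x * x ^ a = urnRatio a p (p + q) * betaPDFReal (p + a) q x := by
  by_cases hx : 0 < x ∧ x < 1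
  · have h1 := beta_pos hp hq
    have h2 := beta_pos (by positivity : 0 < p + a) hq
    rw [betaPDFReal, betaPDFReal, if_pos hx, if_pos hx,
      show p + a - 1 = (p - 1) + a by ring, Real.rpow_add_natCast hx.1.ne']
    have h3 : urnRatio a p (p + q) = beta (p + a) q / beta p q := by
      rw [beta_add_nat hp hq]
      field_simp
    rw [h3]
    field_simp
  · rw [betaPDFReal, betaPDFReal, if_neg hx, if_neg hx, zero_mul, mul_zero]

theorem integral_pow_betaMeasure {p q : ℝ} (hp : 0 < p) (hq : 0 < q) (a : ℕ) :
    ∫ x, x ^ a ∂betaMeasure p q = urnRatio a p (p + q) := by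
  have hm : Measurable (betaPDF p q) := (measurable_betaPDFReal p q).ennreal_ofReal
  rw [betaMeasure, integral_withDensity_eq_integral_toReal_smul hm
    (ae_of_all _ fun x => ENNReal.ofReal_lt_top)]
  have h : ∀ x, (betaPDF p q x).toReal • x ^ a =
      urnRatio a p (p + q) * betaPDFReal (p + a) q x := fun x => by
    rw [← pow_mul_betaPDFReal hp hq, betaPDF, ENNReal.toReal_ofReal, smul_eq_mul]
    by_cases hx : 0 < x ∧ x < 1
    · exact (betaPDFReal_pos hx.1 hx.2 hp hq).le
    · rw [betaPDFReal, if_neg hx]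
  simp only [h]
  rw [integral_const_mul, integral_betaPDFReal (by positivity) hq, mul_one]

theorem ae_betaMeasure_mem_Icc (p q : ℝ) : ∀ᵐ x ∂betaMeasure p q, x ∈ Set.Icc (0 : ℝ) 1 := by
  have hm : Measurable (betaPDF p q) := (measurable_betaPDFReal p q).ennreal_ofReal
  rw [betaMeasure, ae_withDensity_iff hm]
  refine ae_of_all _ fun x hx => ?_
  by_contra h
  rw [Set.mem_Icc, not_and_or, not_le, not_le] at h
  rcases h with h | h
  · exact hx (betaPDF_eq_zero_of_nonpos h.le)
  · exact hx (betaPDF_eq_zero_of_one_le h.le)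

/-! ### Measures on cubes are determined by their moments -/

/-- Finite measures on a Polish space are determined by the integrals of a separating family of
bounded continuous functions that is closed under products. -/
theorem ext_of_forall_mem_submonoid_integral_eq {E : Type*} [TopologicalSpace E] [PolishSpace E]
    [MeasurableSpace E] [BorelSpace E] {μ ν : Measure E} [IsFiniteMeasure μ] [IsFiniteMeasure ν]
    (M : Submonoid (BoundedContinuousFunction E ℝ))
    (hM : ∀ x y : E, x ≠ y → ∃ f ∈ M, f x ≠ f y)
    (h : ∀ f ∈ M, ∫ x, f x ∂μ = ∫ x, f x ∂ν) : μ = ν := by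
  let A : StarSubalgebra ℝ (BoundedContinuousFunction E ℝ) :=
    { Algebra.adjoin ℝ (M : Set (BoundedContinuousFunction E ℝ)) with
      star_mem' := fun {f} hf => by
        have : star f = f := by ext x; simp
        rwa [this] }
  refine ext_of_forall_mem_subalgebra_integral_eq_of_polish (𝕜 := ℝ) (A := A) ?_ ?_
  · intro x y hxy
    obtain ⟨f, hf, hfxy⟩ := hM x y hxy
    exact ⟨f, ⟨f.toContinuousMap, ⟨f, Algebra.subset_adjoin hf, rfl⟩, rfl⟩, hfxy⟩
  · intro g hg
    -- The algebra generated by a multiplicative submonoid is its linear span, so linearity of the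
    -- integral suffices.
    have hg' : g ∈ Submodule.span ℝ (M : Set (BoundedContinuousFunction E ℝ)) := by
      have h1 : g ∈ Subalgebra.toSubmodule
        (Algebra.adjoin ℝ (M : Set (BoundedContinuousFunction E ℝ))) := hg
      rwa [Algebra.adjoin_eq_span, Submonoid.closure_eq] at h1
    clear hg
    induction hg' using Submodule.span_induction with
    | mem f hf => exact h f hf
    | zero => simp
    | add f g _ _ hf hg =>
      simp only [BoundedContinuousFunction.coe_add, Pi.add_apply]
      rw [integral_add (f.integrable _) (g.integrable _),
        integral_add (f.integrable _) (g.integrable _), hf, hg]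
    | smul c f _ hf =>
      simp only [BoundedContinuousFunction.coe_smul]
      rw [integral_smul, integral_smul, hf]

/-- A coordinate of a cube. -/
noncomputable def coordinate {ι : Type*} (i : ι) :
    BoundedContinuousFunction (ι → unitInterval) ℝ :=
  BoundedContinuousFunction.ofNormedAddCommGroup (fun x => (x i : ℝ))
    (continuous_subtype_val.comp (continuous_apply i)) 1 fun x => by
      rw [Real.norm_of_nonneg (x i).2.1]
      exact (x i).2.2

/-- The coordinates separate points, and the monoid that they generate consists of the monomials. -/
theorem ext_of_moments {ι : Type*} [Fintype ι] {μ ν : Measure (ι → unitInterval)}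
    [IsFiniteMeasure μ] [IsFiniteMeasure ν]
    (h : ∀ e : ι → ℕ, ∫ x, ∏ i, (x i : ℝ) ^ e i ∂μ = ∫ x, ∏ i, (x i : ℝ) ^ e i ∂ν) : μ = ν := by
  refine ext_of_forall_mem_submonoid_integral_eq
    (Submonoid.closure (Set.range (coordinate (ι := ι)))) (fun x y hxy => ?_) fun f hf => ?_
  · obtain ⟨i, hi⟩ := Function.ne_iff.1 hxy
    exact ⟨coordinate i, Submonoid.subset_closure ⟨i, rfl⟩, fun h => hi (Subtype.ext h)⟩
  · have : ∃ e : ι → ℕ, ∀ x, f x = ∏ i, (x i : ℝ) ^ e i := by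
      classical
      induction hf using Submonoid.closure_induction with
      | mem f hf =>
        obtain ⟨i, rfl⟩ := hf
        refine ⟨Pi.single i 1, fun x => ?_⟩
        rw [Finset.prod_eq_single i]
        · simp [coordinate]
        · intro j _ hj
          simp [hj]
        · simp
      | one => exact ⟨0, fun x => by simp⟩
      | mul f g _ _ hf hg =>
        obtain ⟨e, he⟩ := hf
        obtain ⟨e', he'⟩ := hg
        refine ⟨e + e', fun x => ?_⟩
        simp only [BoundedContinuousFunction.coe_mul, Pi.mul_apply, he, he', Pi.add_apply, pow_add,
          Finset.prod_mul_distrib]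
    obtain ⟨e, he⟩ := this
    simp only [he]
    exact h e

variable {Ω : Type*} [MeasurableSpace Ω] {P : Measure Ω}

theorem measurable_iSup_comap {Ω ι : Type*} (X : ι → Ω → ℝ) (S : Set ι) {i : ι} (hi : i ∈ S) :
    Measurable[⨆ j ∈ S, MeasurableSpace.comap (X j) inferInstance] (X i) :=
  (comap_measurable (X i)).mono
    (le_iSup₂ (f := fun j (_ : j ∈ S) => MeasurableSpace.comap (X j) inferInstance) i hi) le_rfl

/-- Disjoint subfamilies of an independent family are independent. -/
theorem iIndepFun.indepFun_of_disjoint {ι γ δ : Type*} [MeasurableSpace γ] [MeasurableSpace δ]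
    {X : ι → Ω → ℝ} (hX : ∀ i, Measurable (X i)) (h : iIndepFun X P) {S T : Set ι}
    (hST : Disjoint S T) {U : Ω → γ} {V : Ω → δ}
    (hU : Measurable[⨆ j ∈ S, MeasurableSpace.comap (X j) inferInstance] U)
    (hV : Measurable[⨆ j ∈ T, MeasurableSpace.comap (X j) inferInstance] V) :
    IndepFun U V P := by
  have h1 := indep_iSup_of_disjoint (fun i => (hX i).comap_le) h hST
  exact (IndepFun_iff_Indep _ _ _).2
    (indep_of_indep_of_le_left (indep_of_indep_of_le_right h1 hV.comap_le) hU.comap_le)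

variable [IsProbabilityMeasure P]

/-- Random variables in the unit interval with multiplicative mixed moments are independent. -/
theorem iIndepFun_of_moments {ι : Type*} {V : ι → Ω → unitInterval} (hV : ∀ i, Measurable (V i))
    (h : ∀ (S : Finset ι) (e : ι → ℕ), ∫ ω, ∏ i ∈ S, (V i ω : ℝ) ^ e i ∂P =
      ∏ i ∈ S, ∫ ω, (V i ω : ℝ) ^ e i ∂P) : iIndepFun V P := by
  classical
  rw [iIndepFun_iff_finset]
  intro S
  refine (iIndepFun_iff_map_fun_eq_pi_map (ι := S) (f := fun i => V i)
    fun i => (hV i).aemeasurable).2 ?_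
  have : ∀ i : S, IsProbabilityMeasure (P.map (V i)) := fun i =>
    Measure.isProbabilityMeasure_map (hV i).aemeasurable
  have hmeas : Measurable fun ω (i : S) => V i ω := measurable_pi_lambda _ fun i => hV i
  have : IsProbabilityMeasure (P.map fun ω (i : S) => V i ω) :=
    Measure.isProbabilityMeasure_map hmeas.aemeasurable
  refine ext_of_moments fun e => ?_
  have hcont : Continuous fun x : S → unitInterval => ∏ i, (x i : ℝ) ^ e i := by fun_prop
  have hcont' : ∀ a : ℕ, Continuous fun x : unitInterval => (x : ℝ) ^ a := fun a => by fun_prop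
  rw [integral_map hmeas.aemeasurable hcont.aestronglyMeasurable]
  have h1 := integral_fintype_prod_eq_prod (𝕜 := ℝ) (fun (i : S) (x : unitInterval) => (x : ℝ) ^ e i)
    (μ := fun i => P.map (V i))
  refine Eq.trans ?_ h1.symm
  have h2 := h S fun i => if hi : i ∈ S then e ⟨i, hi⟩ else 0
  rw [← Finset.prod_coe_sort S] at h2
  simp only [← Finset.prod_coe_sort S] at h2
  simp only [Finset.coe_mem, dif_pos, Subtype.coe_eta] at h2
  refine h2.trans (Finset.prod_congr rfl fun i _ => ?_)
  rw [integral_map (hV i).aemeasurable (hcont' _).aestronglyMeasurable]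

/-- The beta distributions are characterized by their moments. -/
theorem map_eq_betaMeasure {V : Ω → unitInterval} (hV : Measurable V) {p q : ℝ} (hp : 0 < p)
    (hq : 0 < q) (h : ∀ a : ℕ, ∫ ω, (V ω : ℝ) ^ a ∂P = urnRatio a p (p + q)) :
    P.map (fun ω => (V ω : ℝ)) = betaMeasure p q := by
  have := isProbabilityMeasureBeta hp hq
  have hproj : Measurable (Set.projIcc (0 : ℝ) 1 zero_le_one) := continuous_projIcc.measurable
  have : IsProbabilityMeasure (P.map V) := Measure.isProbabilityMeasure_map hV.aemeasurable
  have : IsProbabilityMeasure ((betaMeasure p q).map (Set.projIcc (0 : ℝ) 1 zero_le_one)) :=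
    Measure.isProbabilityMeasure_map hproj.aemeasurable
  let f : BoundedContinuousFunction unitInterval ℝ :=
    BoundedContinuousFunction.ofNormedAddCommGroup (fun x : unitInterval => (x : ℝ))
      continuous_subtype_val 1 fun x => by
        rw [Real.norm_of_nonneg x.2.1]
        exact x.2.2
  -- The comparison takes place on the unit interval, where powers are bounded; the projection
  -- changes nothing almost surely, as the beta law lives there.
  have hlaw : P.map V = (betaMeasure p q).map (Set.projIcc (0 : ℝ) 1 zero_le_one) := by
    refine ext_of_forall_mem_submonoid_integral_eq (Submonoid.powers f)
      (fun x y hxy => ⟨f, Submonoid.mem_powers f, fun h => hxy (Subtype.ext h)⟩) ?_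
    rintro _ ⟨a, rfl⟩
    have hcont : Continuous fun x : unitInterval => (x : ℝ) ^ a := by fun_prop
    have hf : ∀ x : unitInterval, (f ^ a) x = (x : ℝ) ^ a := fun x => rfl
    simp only [hf]
    rw [integral_map hV.aemeasurable hcont.aestronglyMeasurable,
      integral_map hproj.aemeasurable hcont.aestronglyMeasurable, h,
      ← integral_pow_betaMeasure hp hq]
    refine integral_congr_ae ?_
    filter_upwards [ae_betaMeasure_mem_Icc p q] with x hx
    rw [Set.projIcc_of_mem _ hx]
  have h1 : P.map (fun ω => (V ω : ℝ)) = (P.map V).map Subtype.val :=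
    (Measure.map_map measurable_subtype_coe hV).symm
  rw [h1, hlaw, Measure.map_map measurable_subtype_coe hproj]
  conv_rhs => rw [← Measure.map_id (μ := betaMeasure p q)]
  refine Measure.map_congr ?_
  filter_upwards [ae_betaMeasure_mem_Icc p q] with x hx
  simp [Set.projIcc_of_mem _ hx]

/-! ### Conditional independence -/

section CondIndep

variable {β γ δ γ' δ' : Type*} [mβ : MeasurableSpace β] [MeasurableSpace γ] [MeasurableSpace δ]
  [MeasurableSpace γ'] [MeasurableSpace δ']

/-- By independence the joint law is a product; Fubini's theorem over the sets `X ⁻¹' C` identifies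
the conditional probability as the measure of the section at `X`. -/
theorem condExp_indicator_of_indepFun {X : Ω → β} {U : Ω → γ} (hX : Measurable X)
    (hU : Measurable U) (hXU : IndepFun X U P) {S : Set (β × γ)} (hS : MeasurableSet S) :
    P⟦(fun ω => (X ω, U ω)) ⁻¹' S | mβ.comap X⟧ =ᵐ[P]
      fun ω => (P.map U).real (Prod.mk (X ω) ⁻¹' S) := by
  have : IsProbabilityMeasure (P.map U) := Measure.isProbabilityMeasure_map hU.aemeasurable
  have : IsProbabilityMeasure (P.map X) := Measure.isProbabilityMeasure_map hX.aemeasurable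
  have hXUm : Measurable fun ω => (X ω, U ω) := hX.prodMk hU
  have hsec : Measurable fun x => (P.map U).real (Prod.mk x ⁻¹' S) :=
    (measurable_measure_prodMk_left hS).ennreal_toReal
  have hint : Integrable (fun ω => (P.map U).real (Prod.mk (X ω) ⁻¹' S)) P :=
    Integrable.of_bound (C := 1) (hsec.comp hX).aestronglyMeasurable (ae_of_all _ fun ω => by
      rw [Real.norm_of_nonneg measureReal_nonneg]
      exact measureReal_le_one)
  refine (ae_eq_condExp_of_forall_setIntegral_eq hX.comap_le
    ((integrable_const (1 : ℝ)).indicator (hXUm hS)) (fun _ _ _ => hint.integrableOn) ?_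
    (hsec.comp (comap_measurable X)).aestronglyMeasurable).symm
  rintro _ ⟨C, hC, rfl⟩ -
  have h1 : ∫ ω in X ⁻¹' C, (P.map U).real (Prod.mk (X ω) ⁻¹' S) ∂P =
      ∫ x in C, (P.map U).real (Prod.mk x ⁻¹' S) ∂(P.map X) :=
    (setIntegral_map hC hsec.aestronglyMeasurable hX.aemeasurable).symm
  have h2 : (fun ω => (X ω, U ω)) ⁻¹' S ∩ X ⁻¹' C = (fun ω => (X ω, U ω)) ⁻¹' (S ∩ C ×ˢ Set.univ) := by
    ext ω
    simp
  have h3 : MeasurableSet (S ∩ C ×ˢ (Set.univ : Set γ)) := hS.inter (hC.prod MeasurableSet.univ)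
  rw [h1, setIntegral_indicator (hXUm hS), setIntegral_const, smul_eq_mul, mul_one, Set.inter_comm,
    h2, ← map_measureReal_apply hXUm h3, (indepFun_iff_map_prod_eq_prod_map_map hX.aemeasurable
      hU.aemeasurable).1 hXU, measureReal_def, Measure.prod_apply h3]
  simp only [measureReal_def]
  rw [integral_toReal (measurable_measure_prodMk_left hS).aemeasurable
    (ae_of_all _ fun x => measure_lt_top _ _), ← lintegral_indicator hC]
  congr 2
  ext x
  by_cases hx : x ∈ C
  · rw [Set.indicator_of_mem hx]
    congr 1
    ext u
    simp [hx]
  · rw [Set.indicator_of_notMem hx]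
    have he : Prod.mk x ⁻¹' (S ∩ C ×ˢ (Set.univ : Set γ)) = ∅ := by
      ext u
      simp [hx]
    rw [he, measure_empty]

/-- Functions of a common variable and of two further independent variables are conditionally
independent given the common variable. -/
theorem condIndepGiven_of_indepFun {X : Ω → β} {U : Ω → γ} {V : Ω → δ} (hX : Measurable X)
    (hU : Measurable U) (hV : Measurable V) (hUV : IndepFun U V P)
    (hXUV : IndepFun X (fun ω => (U ω, V ω)) P) {g : β × γ → γ'} {h : β × δ → δ'}
    (hg : Measurable g) (hh : Measurable h) :
    CondIndepGiven P X (fun ω => g (X ω, U ω)) (fun ω => h (X ω, V ω)) := by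
  intro A B hA hB
  have hXU : IndepFun X U P := hXUV.comp measurable_id measurable_fst
  have hXV : IndepFun X V P := hXUV.comp measurable_id measurable_snd
  have : IsProbabilityMeasure (P.map U) := Measure.isProbabilityMeasure_map hU.aemeasurable
  have : IsProbabilityMeasure (P.map V) := Measure.isProbabilityMeasure_map hV.aemeasurable
  have hgh : MeasurableSet {z : β × γ × δ | g (z.1, z.2.1) ∈ A ∧ h (z.1, z.2.2) ∈ B} :=
    ((hg.comp (by fun_prop : Measurable fun z : β × γ × δ => (z.1, z.2.1))) hA).inter
      ((hh.comp (by fun_prop : Measurable fun z : β × γ × δ => (z.1, z.2.2))) hB)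
  have h1 := condExp_indicator_of_indepFun hX hU hXU (hg hA)
  have h2 := condExp_indicator_of_indepFun hX hV hXV (hh hB)
  have h3 := condExp_indicator_of_indepFun hX (hU.prodMk hV) hXUV hgh
  filter_upwards [h1, h2, h3] with ω e1 e2 e3
  refine e3.trans ?_
  refine Eq.trans ?_ (congrArg₂ (· * ·) e1 e2).symm
  -- For fixed `X ω` the section of the joint event is a rectangle, so its product measure factors.
  rw [(indepFun_iff_map_prod_eq_prod_map_map hU.aemeasurable hV.aemeasurable).1 hUV,
    ← measureReal_prod_prod]
  rfl

end CondIndep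

end PolyaRecords

namespace PolyaRecords

/-! ### The joint law of the limits -/

section Limits

variable {α : ℤ → ℝ} {θ ζ : ℝ} {Ω : Type*} {π : ∀ n : ℕ, Ω → Equiv.Perm (Fin n)}
  [MeasurableSpace Ω] {P : Measure Ω} [IsProbabilityMeasure P]

/-- Indices outside `S` enter with exponent 0, so a symmetric interval containing `S` reduces this
to `integral_prod_limit`. -/
theorem IsPolyaRecordSequence.integral_prod_finset (h : IsPolyaRecordSequence P π α θ ζ)
    (hdom : PrincipalDomain α θ ζ) (S : Finset ℤ) (e : ℤ → ℕ) :
    ∫ ω, ∏ k ∈ S, (h.limit k ω : ℝ) ^ e k ∂P = ∏ k ∈ S, urnMoment α θ ζ k (e k) := by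
  have hS : S ⊆ Finset.Icc (-((S.sup Int.natAbs : ℕ) : ℤ)) (S.sup Int.natAbs : ℕ) := by
    intro k hk
    have : k.natAbs ≤ S.sup Int.natAbs := Finset.le_sup hk
    rw [Finset.mem_Icc]
    omega
  have hprod : ∀ f : ℤ → ℕ → ℝ, (∀ k, f k 0 = 1) →
      ∏ k ∈ Finset.Icc (-((S.sup Int.natAbs : ℕ) : ℤ)) (S.sup Int.natAbs : ℕ),
        f k (if k ∈ S then e k else 0) = ∏ k ∈ S, f k (e k) := by
    intro f hf
    rw [← Finset.prod_subset hS]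
    · exact Finset.prod_congr rfl fun k hk => by rw [if_pos hk]
    · intro k _ hk
      rw [if_neg hk, hf]
  have := h.integral_prod_limit hdom (fun k => if k ∈ S then e k else 0) (S.sup Int.natAbs)
  rw [hprod (urnMoment α θ ζ) (urnMoment_zero_right α θ ζ)] at this
  rw [← this]
  congr 1
  ext ω
  exact (hprod (fun k a => (h.limit k ω : ℝ) ^ a) fun k => pow_zero _).symm

theorem IsPolyaRecordSequence.integral_limit_pow (h : IsPolyaRecordSequence P π α θ ζ)
    (hdom : PrincipalDomain α θ ζ) (k : ℤ) (a : ℕ) :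
    ∫ ω, (h.limit k ω : ℝ) ^ a ∂P = urnMoment α θ ζ k a := by
  simpa using h.integral_prod_finset hdom {k} fun _ => a

theorem IsPolyaRecordSequence.iIndepFun_limit (h : IsPolyaRecordSequence P π α θ ζ)
    (hdom : PrincipalDomain α θ ζ) : iIndepFun (fun k ω => (h.limit k ω : ℝ)) P :=
  (iIndepFun_of_moments h.measurable_limit fun S e => by
    simp only [h.integral_prod_finset hdom, h.integral_limit_pow hdom]).comp
    (fun _ x => (x : ℝ)) fun _ => measurable_subtype_coe

theorem IsPolyaRecordSequence.map_limit_zero (h : IsPolyaRecordSequence P π α θ ζ)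
    (hdom : PrincipalDomain α θ ζ) :
    P.map (fun ω => (h.limit 0 ω : ℝ)) = betaMeasure θ ζ := by
  refine map_eq_betaMeasure (h.measurable_limit 0) (by simpa using hdom.lower_pos 0)
    (by simpa using hdom.upper_pos 0) fun a => ?_
  rw [h.integral_limit_pow hdom]
  simp [urnMoment]

/-- The urn starts with total A_m + 1 and inner weight A_{m+1}, where k = -(m + 1); the difference 1
- α_k is the second beta parameter. -/
theorem IsPolyaRecordSequence.map_limit_neg (h : IsPolyaRecordSequence P π α θ ζ)
    (hdom : PrincipalDomain α θ ζ) {k : ℤ} (hk : k < 0) :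
    P.map (fun ω => (h.limit k ω : ℝ)) =
      betaMeasure (θ + ∑ j ∈ Finset.Icc k (-1), α j) (1 - α k) := by
  obtain ⟨m, rfl⟩ : ∃ m : ℕ, k = -((m : ℤ) + 1) := ⟨(-k - 1).toNat, by omega⟩
  have h1 : θ + ∑ j ∈ Finset.Icc (-((m : ℤ) + 1)) (-1), α j = lowerSum α θ (m + 1) := by
    simp [lowerSum]
  rw [h1]
  refine map_eq_betaMeasure (h.measurable_limit _) (hdom.lower_pos _)
    (hdom.alpha_lt_one _ hk.ne) fun a => ?_
  rw [h.integral_limit_pow hdom, urnMoment, if_pos hk,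
    show (-((m : ℤ) + 1)).natAbs = m + 1 by omega, Nat.add_sub_cancel]
  congr 1
  rw [lowerSum_succ]
  ring

theorem IsPolyaRecordSequence.map_limit_pos (h : IsPolyaRecordSequence P π α θ ζ)
    (hdom : PrincipalDomain α θ ζ) {k : ℤ} (hk : 0 < k) :
    P.map (fun ω => (h.limit k ω : ℝ)) =
      betaMeasure (ζ + ∑ j ∈ Finset.Icc 1 k, α j) (1 - α k) := by
  obtain ⟨m, rfl⟩ : ∃ m : ℕ, k = (m : ℤ) + 1 := ⟨(k - 1).toNat, by omega⟩
  have h1 : ζ + ∑ j ∈ Finset.Icc 1 ((m : ℤ) + 1), α j = upperSum α ζ (m + 1) := by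
    simp [upperSum]
  rw [h1]
  refine map_eq_betaMeasure (h.measurable_limit _) (hdom.upper_pos _)
    (hdom.alpha_lt_one _ hk.ne') fun a => ?_
  rw [h.integral_limit_pow hdom, urnMoment, if_neg (by omega), if_pos hk,
    show ((m : ℤ) + 1).natAbs = m + 1 by omega, Nat.add_sub_cancel]
  congr 1
  rw [upperSum_succ]
  ring

theorem recordLimit_zero (X : ℤ → ℝ) : recordLimit X 0 = X 0 := by simp [recordLimit]

theorem measurable_recordLimit (k : ℤ) : Measurable fun X : ℤ → ℝ => recordLimit X k := by
  unfold recordLimit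
  split_ifs <;> fun_prop

theorem condIndepGiven_recordLimit {X : ℤ → Ω → ℝ} (hX : ∀ k, Measurable (X k))
    (hind : iIndepFun X P) :
    CondIndepGiven P (X 0)
      (fun ω (k : {k : ℤ // k < 0}) => recordLimit (fun j => X j ω) k)
      (fun ω (k : {k : ℤ // 0 < k}) => recordLimit (fun j => X j ω) k) := by
  let U : Ω → {k : ℤ // k < 0} → ℝ := fun ω k => X k ω
  let V : Ω → {k : ℤ // 0 < k} → ℝ := fun ω k => X k ω
  have hUV : IndepFun U V P := by
    refine iIndepFun.indepFun_of_disjoint hX hind (S := Set.Iio 0) (T := Set.Ioi 0) ?_ ?_ ?_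
    · exact Set.disjoint_left.2 fun x h1 h2 => lt_asymm (Set.mem_Iio.1 h1) (Set.mem_Ioi.1 h2)
    · exact @measurable_pi_lambda _ _ _ (_) _ _ fun k => measurable_iSup_comap X _ k.2
    · exact @measurable_pi_lambda _ _ _ (_) _ _ fun k => measurable_iSup_comap X _ k.2
  have hXUV : IndepFun (X 0) (fun ω => (U ω, V ω)) P := by
    refine iIndepFun.indepFun_of_disjoint hX hind (S := {0}) (T := {0}ᶜ)
      disjoint_compl_right (measurable_iSup_comap X _ rfl) ?_
    refine @Measurable.prodMk _ _ _ _ _ (_) _ _ ?_ ?_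
    · exact @measurable_pi_lambda _ _ _ (_) _ _ fun k => measurable_iSup_comap X _ k.2.ne
    · exact @measurable_pi_lambda _ _ _ (_) _ _ fun k => measurable_iSup_comap X _ k.2.ne'
  -- A lower limit uses only the center and factors of negative index, so the family is rebuilt from
  -- these; the value at positive indices is an irrelevant filler. The map `hh` mirrors this.
  have hg : Measurable fun z : ℝ × ({k : ℤ // k < 0} → ℝ) => fun k : {k : ℤ // k < 0} =>
      recordLimit (fun j => if hj : j < 0 then z.2 ⟨j, hj⟩ else z.1) k := by
    have : Measurable fun z : ℝ × ({k : ℤ // k < 0} → ℝ) => fun j : ℤ =>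
        if hj : j < 0 then z.2 ⟨j, hj⟩ else z.1 := by
      refine measurable_pi_lambda _ fun j => ?_
      split_ifs <;> fun_prop
    exact measurable_pi_lambda _ fun k => (measurable_recordLimit k).comp this
  have hh : Measurable fun z : ℝ × ({k : ℤ // 0 < k} → ℝ) => fun k : {k : ℤ // 0 < k} =>
      recordLimit (fun j => if hj : 0 < j then z.2 ⟨j, hj⟩ else z.1) k := by
    have : Measurable fun z : ℝ × ({k : ℤ // 0 < k} → ℝ) => fun j : ℤ =>
        if hj : 0 < j then z.2 ⟨j, hj⟩ else z.1 := by
      refine measurable_pi_lambda _ fun j => ?_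
      split_ifs <;> fun_prop
    exact measurable_pi_lambda _ fun k => (measurable_recordLimit k).comp this
  have key := condIndepGiven_of_indepFun (hX 0) (measurable_pi_lambda U fun k => hX k)
    (measurable_pi_lambda V fun k => hX k) hUV hXUV hg hh
  have e1 : ∀ ω (k : {k : ℤ // k < 0}), recordLimit (fun j => X j ω) k =
      recordLimit (fun j => if hj : j < 0 then U ω ⟨j, hj⟩ else X 0 ω) k := fun ω k => by
    have hk := k.2
    rw [recordLimit, recordLimit, if_neg (by omega), if_neg (by omega), dif_neg (lt_irrefl _)]
    congr 1
    refine Finset.prod_congr rfl fun j hj => ?_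
    have := Finset.mem_Icc.1 hj
    rw [dif_pos (by omega)]
  have e2 : ∀ ω (k : {k : ℤ // 0 < k}), recordLimit (fun j => X j ω) k =
      recordLimit (fun j => if hj : 0 < j then V ω ⟨j, hj⟩ else X 0 ω) k := fun ω k => by
    have hk := k.2
    rw [recordLimit, recordLimit, if_pos hk, if_pos hk, dif_neg (lt_irrefl _)]
    congr 2
    refine Finset.prod_congr rfl fun j hj => ?_
    have := Finset.mem_Icc.1 hj
    rw [dif_pos (by omega)]
  exact (congrArg₂ (CondIndepGiven P (X 0)) (funext₂ e1) (funext₂ e2)).mpr key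

end Limits

end PolyaRecords

/-! ### The strong law and the stick-breaking representation. -/

theorem proposition10p1 {Ω : Type*} [MeasurableSpace Ω] (P : Measure Ω) [IsProbabilityMeasure P]
    (π : ∀ n : ℕ, Ω → Equiv.Perm (Fin n)) (α : ℤ → ℝ) (θ ζ : ℝ)
    (hdom : PolyaRecords.PrincipalDomain α θ ζ)
    (hπ : PolyaRecords.IsPolyaRecordSequence P π α θ ζ) :
    ∃ ρ T Z : ℤ → Ω → ℝ,
      (∀ k, Measurable (ρ k)) ∧ (∀ k, Measurable (T k)) ∧ (∀ k, Measurable (Z k)) ∧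
      -- strong law for the scaled record values
      (∀ᵐ ω ∂P, ∀ k : ℤ,
        Tendsto (fun n : ℕ => (PolyaRecords.recordValue (π n ω) k : ℝ) / n) atTop (𝓝 (ρ k ω))) ∧
      -- the law of the limit of the scaled center
      P.map (ρ 0) = betaMeasure θ ζ ∧
      -- given `ρ 0`, the lower and the upper limits are independent
      PolyaRecords.CondIndepGiven P (ρ 0)
        (fun ω (k : {k : ℤ // k < 0}) => ρ k ω) (fun ω (k : {k : ℤ // 0 < k}) => ρ k ω) ∧
      -- stick-breaking representation
      (∀ᵐ ω ∂P, ∀ k : ℤ, k < 0 → ρ k ω = ρ 0 ω * ∏ j ∈ Finset.Icc k (-1), T j ω) ∧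
      (∀ᵐ ω ∂P, ∀ k : ℤ, 0 < k → ρ k ω = 1 - (1 - ρ 0 ω) * ∏ j ∈ Finset.Icc 1 k, Z j ω) ∧
      (∀ k : ℤ, k < 0 →
        P.map (T k) = betaMeasure (θ + ∑ j ∈ Finset.Icc k (-1), α j) (1 - α k)) ∧
      (∀ k : ℤ, 0 < k →
        P.map (Z k) = betaMeasure (ζ + ∑ j ∈ Finset.Icc 1 k, α j) (1 - α k)) ∧
      -- `ρ 0`, `T k` for `k < 0` and `Z k` for `k > 0` are all independent
      iIndepFun (fun (k : ℤ) => if k < 0 then T k else if 0 < k then Z k else ρ 0) P := by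
  let X : ℤ → Ω → ℝ := fun k ω => hπ.limit k ω
  have hX : ∀ k, Measurable (X k) := fun k =>
    measurable_subtype_coe.comp (hπ.measurable_limit k)
  let ρ : ℤ → Ω → ℝ := fun k ω => PolyaRecords.recordLimit (fun j => X j ω) k
  have hρ0 : ρ 0 = X 0 := funext fun ω => PolyaRecords.recordLimit_zero _
  have hind : iIndepFun X P := hπ.iIndepFun_limit hdom
  -- The urn limits serve as `T` at negative and as `Z` at positive indices, so the combined family
  -- of the last claim is `X` itself.
  refine ⟨ρ, X, X, fun k => ?_, hX, hX, hπ.tendsto_recordValue hdom, ?_, ?_, ?_, ?_,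
    fun k hk => hπ.map_limit_neg hdom hk, fun k hk => hπ.map_limit_pos hdom hk, ?_⟩
  · exact (PolyaRecords.measurable_recordLimit k).comp (measurable_pi_lambda _ hX)
  · rw [hρ0]
    exact hπ.map_limit_zero hdom
  · rw [hρ0]
    exact PolyaRecords.condIndepGiven_recordLimit hX hind
  · refine ae_of_all _ fun ω k hk => ?_
    rw [hρ0]
    simp only [ρ, PolyaRecords.recordLimit]
    rw [if_neg (by omega)]
  · refine ae_of_all _ fun ω k hk => ?_
    rw [hρ0]
    simp only [ρ, PolyaRecords.recordLimit]
    rw [if_pos hk]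
  · have : (fun k : ℤ => if k < 0 then X k else if 0 < k then X k else ρ 0) = X := by
      funext k
      split_ifs with h1 h2
      · rfl
      · rfl
      · rw [hρ0, show k = 0 by omega]
    rw [this]
    exact hind
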